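/- Let $m,n\ge 0$ be integers. Consider the following seven families. 1. **$m\times n$ partial alternating sign matrices:** $m\times n$ matrices $M$ with entries in $\{-1,0,1\}$ such that every row and every column has sum $0$ or $1$, the nonzero entries of every row and column alternate in sign, the first nonzero entry (if any) of every column is $1$, and the last nonzero entry (if any) of every row is $1$. 2. **$(m,n)$-partial monotone triangles:** arrays $(a_{i,j})_{1\le j\le i\le m}$ with entries in $\{0,\dots,n\}$ such that rows are weakly increasing, the nonzero entries of each row are strictly increasing, and $a_{i,j}\le a_{i-1,j}$ and $a_{i,j}\le a_{i+1,j+1}$ whenever these entries exist. 3. **$(m,n)$-partial height-function matrices:** integer matrices $(h_{i,j})_{0\le i\le m,\,0\le j\le n}$ with $h_{i,j}\ge 0$, $h_{0,k}=k$ for $0\le k\le n$, $h_{\ell,0}=\ell$ for $0\le \ell\le m$, and any two row-adjacent or column-adjacent entries differing by $\pm1$. 4. **$(m,n)$-partial fully-packed loop configurations.** Let $G_{m,n}$ be the graph whose vertices are $v_{i,j}$ ($0\le i\le m+1$, $0\le j\le n+1$) with the four corners removed, and whose edges are $v_{i,j}v_{i+1,j}$ ($0\le i\le m$, $1\le j\le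 n$) and $v_{i,j}v_{i,j+1}$ ($1\le i\le m$, $0\le j\le n$). The vertices with $1\le i\le m$, $1\le j\le n$ are internal; $v_{i,j}$ is even or odd according to the parity of $i+j$. A configuration is a spanning subgraph of $G_{m,n}$ in which every internal vertex has degree $2$, and which, among the edges $v_{0,j}v_{1,j}$ ($1\le j\le n$) and $v_{i,0}v_{i,1}$ ($1\le i\le m$), contains exactly the $v_{0,j}v_{1,j}$ with $j$ odd and the $v_{i,0}v_{i,1}$ with $i$ even. 5. **$(m,n)$-rectangular ice configurations:** orientations of $G_{m,n}$ in which every edge $v_{i,0}v_{i,1}$ is directed towards $v_{i,1}$, every edge $v_{0,j}v_{1,j}$ is directed towards $v_{0,j}$, and every internal vertex has in-degree and out-degree $2$. 6. **Order ideals** (down-closed subsets) of the poset $\mathbf P_{m,n}$ of all $(i,j,k)\in\mathbb Z^3$ with $0\le k\le m-1$, $k\le i\le m-1$, $k\le j\le n-1$, ordered by the reflexive transitive closure of the relations that $(i,j,k)$ lies above $(i+1,j,k)$, $(i,j+1,k)$, $(i-1,j,k-1)$ and $(i,j-1,k-1)$ whenever these are elements. 7. **$(m,n)$-nests of osculating paths:**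 sets of pairwise osculating lattice paths with south and east steps (possibly of length $0$) in the grid of the $m\cdot n$ points $(i,j)$, $1\le i\le m$, $1\le j\le n$ (row, column), each starting in column $1$ and ending in row $m$. Two distinct paths osculate if they have no step in common and every common point is a corner (a south step into the point followed by an east step out of it) of one of the two paths. The following explicit maps are well defined and are bijections; hence, by composition and inversion, there are explicit bijections between any two of the seven families. - $1\to 2$: the $i$th row of the triangle lists in increasing order the $j$ with $\sum_{k\le i}M_{k,j}=1$, filled up with zeros from the left to length $i$. - $1\to 3$: $h_{i,j}=i+j-2c_{i,n-j}$, where $c_{i,j}=\sum_{i'\le i,\;j'>j}M_{i',j'}$. - $3\to 4$: the edge $v_{i,j}v_{i+1,j}$ is present iff $\{h_{i,j-1},h_{i,j}\}=\{2k,2k+1\}$ for some integer $k$, and the edge $v_{i,j}v_{i,j+1}$ is present iff $\{h_{i-1,j},h_{i,j}\}=\{2k-1,2k\}$ for some integer $k$. - $5\to 4$: keep the edges directed from an even to an odd vertex and forget their directions. - $6\to 3$: $\mathcal O\mapsto (h_{i,j})$ with $h_{i,j}=i+j-2\,\#\{k:(i-1,j-1,k)\in\mathcal O\}$. - $1\to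 7$: one path starts at $(i,1)$ for every row $i$ of sum $1$. At a point $(i,j)$ a path goes east if $\sum_{j'>j}M_{i,j'}=1$ and moreover the path entered $(i,j)$ from the north or $\sum_{i'<i}M_{i',j}\ne1$; otherwise it goes south, or it ends there if $i=m$. -/

import Mathlib

namespace PartialASM

/-! ### Partial alternating sign matrices -/

/-- `m × n` partial alternating sign matrices. Rows and columns are numbered from `0` here. -/
structure IsPASM {m n : ℕ} (M : Matrix (Fin m) (Fin n) ℤ) : Prop where
  entries : ∀ i j, M i j = -1 ∨ M i j = 0 ∨ M i j = 1
  row_sum : ∀ i, ∑ j, M i j = 0 ∨ ∑ j, M i j = 1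
  col_sum : ∀ j, ∑ i, M i j = 0 ∨ ∑ i, M i j = 1
  /-- Two consecutive nonzero entries of a row have opposite signs. -/
  row_alternates : ∀ i j j', j < j' → M i j ≠ 0 → M i j' ≠ 0 →
    (∀ l, j < l → l < j' → M i l = 0) → M i j' = -M i j
  /-- Two consecutive nonzero entries of a column have opposite signs. -/
  col_alternates : ∀ j i i', i < i' → M i j ≠ 0 → M i' j ≠ 0 →
    (∀ l, i < l → l < i' → M l j = 0) → M i' j = -M i j
  /-- The first nonzero entry of a column, if any, is `1`. -/
  col_first : ∀ i j, M i j ≠ 0 → (∀ i', i' < i → M i' j = 0) → M i j = 1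
  /-- The last nonzero entry of a row, if any, is `1`. -/
  row_last : ∀ i j, M i j ≠ 0 → (∀ j', j < j' → M i j' = 0) → M i j = 1

/-- The set of `m × n` partial alternating sign matrices. -/
def PASM (m n : ℕ) : Set (Matrix (Fin m) (Fin n) ℤ) := {M | IsPASM M}

/-! ### Partial monotone triangles -/

/-- Triangular arrays of natural numbers with `m` rows: with rows numbered from `0`, row `i` has
`i + 1` entries. -/
abbrev TriangularArray (m : ℕ) : Type := (i : Fin m) → Fin (i.val + 1) → ℕ

/-- `(m, n)`-partial monotone triangles. -/
structure IsPartialMonotoneTriangle (m n : ℕ) (a : TriangularArray m) : Prop where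
  entries : ∀ i j, a i j ≤ n
  row_weak : ∀ i, Monotone (a i)
  row_strict : ∀ i j j', j < j' → a i j ≠ 0 → a i j' ≠ 0 → a i j < a i j'
  /-- Diagonals from southwest to northeast increase weakly. -/
  diag_up : ∀ (i : Fin m) (h : i.val + 1 < m) (j : Fin (i.val + 1)),
    a ⟨i.val + 1, h⟩ j.castSucc ≤ a i j
  /-- Diagonals from northwest to southeast increase weakly. -/
  diag_down : ∀ (i : Fin m) (h : i.val + 1 < m) (j : Fin (i.val + 1)),
    a i j ≤ a ⟨i.val + 1, h⟩ j.succ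

/-- The set of `(m, n)`-partial monotone triangles. -/
def PartialMonotoneTriangles (m n : ℕ) : Set (TriangularArray m) :=
  {a | IsPartialMonotoneTriangle m n a}

/-- The partial column sum of `M` over the rows up to and including row `i`. -/
def colPartialSum {m n : ℕ} (M : Matrix (Fin m) (Fin n) ℤ) (i : Fin m) (j : Fin n) : ℤ :=
  ∑ i' with i' ≤ i, M i' j

/-- The columns, numbered from `1`, whose partial sum down to row `i` equals `1`. -/
def activeColumns {m n : ℕ} (M : Matrix (Fin m) (Fin n) ℤ) (i : Fin m) : Finset ℕ :=
  (Finset.univ.filter fun j : Fin n => colPartialSum M i j = 1).image fun j => j.val + 1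

/-- The triangular array of a matrix: row `i` lists in increasing order the columns whose partial
sum down to row `i` is `1`, filled up with zeros from the left. -/
def pasmToTriangle {m n : ℕ} (M : Matrix (Fin m) (Fin n) ℤ) : TriangularArray m := fun i j =>
  (List.replicate (i.val + 1 - (activeColumns M i).card) 0 ++ (activeColumns M i).sort).getD
    j.val 0

/-! ### Partial height-function matrices -/

/-- `(m, n)`-partial height-function matrices `(h i j)`, `0 ≤ i ≤ m`, `0 ≤ j ≤ n`. -/
structure IsPartialHeightFunction {m n : ℕ} (h : Matrix (Fin (m + 1)) (Fin (n + 1)) ℤ) :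
    Prop where
  nonneg : ∀ i j, 0 ≤ h i j
  first_row : ∀ k : Fin (n + 1), h 0 k = (k.val : ℤ)
  first_col : ∀ l : Fin (m + 1), h l 0 = (l.val : ℤ)
  row_adjacent : ∀ (i : Fin (m + 1)) (j : Fin n), |h i j.succ - h i j.castSucc| = 1
  col_adjacent : ∀ (i : Fin m) (j : Fin (n + 1)), |h i.succ j - h i.castSucc j| = 1

/-- The set of `(m, n)`-partial height-function matrices. -/
def PartialHeightFunctions (m n : ℕ) : Set (Matrix (Fin (m + 1)) (Fin (n + 1)) ℤ) :=
  {h | IsPartialHeightFunction h}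

/-- The north-east corner sum `c_{i,j}`, `0 ≤ i ≤ m`, `0 ≤ j ≤ n`: the sum of the entries of `M`
in its first `i` rows and outside its first `j` columns. -/
def cornerSum {m n : ℕ} (M : Matrix (Fin m) (Fin n) ℤ) (i j : ℕ) : ℤ :=
  ∑ i' : Fin m with i'.val < i, ∑ j' : Fin n with j ≤ j'.val, M i' j'

/-- `h_{i,j} = i + j - 2 c_{i,n-j}`. -/
def pasmToHeight {m n : ℕ} (M : Matrix (Fin m) (Fin n) ℤ) :
    Matrix (Fin (m + 1)) (Fin (n + 1)) ℤ := fun i j =>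
  (i.val : ℤ) + (j.val : ℤ) - 2 * cornerSum M i.val (n - j.val)

/-! ### The grid graph -/

/-- Vertices `v_{i,j}`, `0 ≤ i ≤ m + 1`, `0 ≤ j ≤ n + 1`, without the four corners. -/
abbrev GridVertex (m n : ℕ) : Type :=
  {v : ℕ × ℕ // v.1 ≤ m + 1 ∧ v.2 ≤ n + 1 ∧ ¬((v.1 = 0 ∨ v.1 = m + 1) ∧ (v.2 = 0 ∨ v.2 = n + 1))}

namespace GridVertex

variable {m n : ℕ}

/-- The row index of a vertex. -/
def row (v : GridVertex m n) : ℕ := v.1.1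

/-- The column index of a vertex. -/
def col (v : GridVertex m n) : ℕ := v.1.2

/-- Internal vertices. -/
def IsInternal (v : GridVertex m n) : Prop := 1 ≤ v.row ∧ v.row ≤ m ∧ 1 ≤ v.col ∧ v.col ≤ n

/-- Even vertices. -/
def IsEven (v : GridVertex m n) : Prop := Even (v.row + v.col)

/-- Odd vertices. -/
def IsOdd (v : GridVertex m n) : Prop := Odd (v.row + v.col)

end GridVertex

/-- The pair `v_{i,j}, v_{i+1,j}` with `1 ≤ j ≤ n`, or `v_{i,j}, v_{i,j+1}` with `1 ≤ i ≤ m`. -/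
def GridEdge {m n : ℕ} (u v : GridVertex m n) : Prop :=
  (v.row = u.row + 1 ∧ v.col = u.col ∧ 1 ≤ u.col ∧ u.col ≤ n) ∨
    (v.row = u.row ∧ v.col = u.col + 1 ∧ 1 ≤ u.row ∧ u.row ≤ m)

/-- The graph `G_{m,n}`. -/
def gridGraph (m n : ℕ) : SimpleGraph (GridVertex m n) := SimpleGraph.fromRel GridEdge

/-! ### Partial fully-packed loop configurations -/

/-- `(m, n)`-partial fully-packed loop configurations: (spanning) subgraphs of `G_{m,n}`, whose
edges on the top boundary are the `v_{0,j} v_{1,j}` with `j` odd, whose edges on the left boundary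
are the `v_{i,0} v_{i,1}` with `i` even, and in which every internal vertex has degree two. -/
structure IsPartialFPL {m n : ℕ} (H : SimpleGraph (GridVertex m n)) : Prop where
  le_grid : H ≤ gridGraph m n
  top : ∀ u v : GridVertex m n, u.row = 0 → v.row = 1 → u.col = v.col →
    (H.Adj u v ↔ Odd u.col)
  left : ∀ u v : GridVertex m n, u.col = 0 → v.col = 1 → u.row = v.row →
    (H.Adj u v ↔ Even u.row)
  degree : ∀ v : GridVertex m n, v.IsInternal → (H.neighborSet v).ncard = 2

/-- The set of `(m, n)`-partial fully-packed loop configurations. -/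
def PartialFPLs (m n : ℕ) : Set (SimpleGraph (GridVertex m n)) := {H | IsPartialFPL H}

/-- The entry `h i j` is placed in the square with corners `v_{i,j}`, `v_{i,j+1}`, `v_{i+1,j}`,
`v_{i+1,j+1}`. The edge `v_{i,j} v_{i+1,j}` separates `h i (j-1)` and `h i j`, and it is drawn if
these are `2k` and `2k+1` in either order. The edge `v_{i,j} v_{i,j+1}` separates `h (i-1) j` and
`h i j`, and it is drawn if these are `2k-1` and `2k` in either order. -/
def DrawnEdge {m n : ℕ} (h : Matrix (Fin (m + 1)) (Fin (n + 1)) ℤ) (u v : GridVertex m n) :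
    Prop :=
  (∃ (i : Fin (m + 1)) (j : Fin n) (k : ℤ),
    u.row = i.val ∧ u.col = j.val + 1 ∧ v.row = i.val + 1 ∧ v.col = j.val + 1 ∧
      ((h i j.castSucc = 2 * k ∧ h i j.succ = 2 * k + 1) ∨
        (h i j.castSucc = 2 * k + 1 ∧ h i j.succ = 2 * k))) ∨
  (∃ (i : Fin m) (j : Fin (n + 1)) (k : ℤ),
    u.row = i.val + 1 ∧ u.col = j.val ∧ v.row = i.val + 1 ∧ v.col = j.val + 1 ∧
      ((h i.castSucc j = 2 * k - 1 ∧ h i.succ j = 2 * k) ∨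
        (h i.castSucc j = 2 * k ∧ h i.succ j = 2 * k - 1)))

/-- The subgraph of `G_{m,n}` drawn from a height-function matrix. -/
def heightToFPL {m n : ℕ} (h : Matrix (Fin (m + 1)) (Fin (n + 1)) ℤ) :
    SimpleGraph (GridVertex m n) := SimpleGraph.fromRel (DrawnEdge h)

/-! ### Rectangular ice configurations -/

/-- `(m, n)`-rectangular ice configurations: orientations of `G_{m,n}` in which the edges on the
left boundary point inward, the edges on the top boundary point outward, and every internal vertex
has in-degree and out-degree two. -/
structure IsRectangularIce {m n : ℕ} (D : Digraph (GridVertex m n)) : Prop where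
  underlying : ∀ u v, (D.Adj u v ∨ D.Adj v u) ↔ (gridGraph m n).Adj u v
  oriented : ∀ u v, ¬(D.Adj u v ∧ D.Adj v u)
  left : ∀ u v : GridVertex m n, u.col = 0 → v.col = 1 → u.row = v.row → D.Adj u v
  top : ∀ u v : GridVertex m n, u.row = 0 → v.row = 1 → u.col = v.col → D.Adj v u
  in_degree : ∀ v : GridVertex m n, v.IsInternal → {u | D.Adj u v}.ncard = 2
  out_degree : ∀ v : GridVertex m n, v.IsInternal → {u | D.Adj v u}.ncard = 2

/-- The set of `(m, n)`-rectangular ice configurations. -/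
def RectangularIce (m n : ℕ) : Set (Digraph (GridVertex m n)) := {D | IsRectangularIce D}

/-- Keep the edges directed from an even to an odd vertex and forget their directions. -/
def iceToFPL {m n : ℕ} (D : Digraph (GridVertex m n)) : SimpleGraph (GridVertex m n) :=
  SimpleGraph.fromRel fun u v => D.Adj u v ∧ u.IsEven ∧ v.IsOdd

/-! ### The PASM poset -/

/-- The elements `(i, j, k)` of the poset `P_{m,n}`. -/
@[ext]
structure PASMPoset (m n : ℕ) where
  i : ℤ
  j : ℤ
  k : ℤ
  k_nonneg : 0 ≤ k
  k_le : k ≤ (m : ℤ) - 1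
  k_le_j : k ≤ j
  j_le : j ≤ (n : ℤ) - 1
  k_le_i : k ≤ i
  i_le : i ≤ (m : ℤ) - 1

namespace PASMPoset

variable {m n : ℕ}

/-- `x.CoveredBy y`: the element `y = (i, j, k)` covers `x`, that is, `x` is one of
`(i + 1, j, k)`, `(i, j + 1, k)`, `(i - 1, j, k - 1)`, `(i, j - 1, k - 1)`. -/
def CoveredBy (x y : PASMPoset m n) : Prop :=
  (x.i = y.i + 1 ∧ x.j = y.j ∧ x.k = y.k) ∨
  (x.i = y.i ∧ x.j = y.j + 1 ∧ x.k = y.k) ∨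
  (x.i = y.i - 1 ∧ x.j = y.j ∧ x.k = y.k - 1) ∨
  (x.i = y.i ∧ x.j = y.j - 1 ∧ x.k = y.k - 1)

theorem eq_or_lt_of_reflTransGen {x y : PASMPoset m n}
    (h : Relation.ReflTransGen CoveredBy x y) :
    x = y ∨ 2 * x.k - x.i - x.j < 2 * y.k - y.i - y.j := by
  induction h with
  | refl => exact Or.inl rfl
  | tail _ hbc ih =>
    right
    rcases ih with rfl | ih <;> rcases hbc with h | h | h | h <;> omega

/-- The partial order generated by the covering relations. -/
instance : PartialOrder (PASMPoset m n) where
  le := Relation.ReflTransGen CoveredBy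
  le_refl _ := Relation.ReflTransGen.refl
  le_trans _ _ _ := Relation.ReflTransGen.trans
  le_antisymm x y hxy hyx := by
    rcases eq_or_lt_of_reflTransGen hxy with h | h
    · exact h
    · rcases eq_or_lt_of_reflTransGen hyx with h' | h'
      · exact h'.symm
      · omega

end PASMPoset

/-- `h_{i,j} = i + j - 2 t`, where `t` is the number of elements of the order ideal `I` on the
vertical line over `(i - 1, j - 1)`; in particular `h_{i,j} = i + j` if `i = 0` or `j = 0`. -/
noncomputable def idealToHeight {m n : ℕ} (I : LowerSet (PASMPoset m n)) :
    Matrix (Fin (m + 1)) (Fin (n + 1)) ℤ := fun i j =>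
  (i.val : ℤ) + (j.val : ℤ) -
    2 * ({x : PASMPoset m n | x ∈ I ∧ x.i = (i.val : ℤ) - 1 ∧ x.j = (j.val : ℤ) - 1}.ncard : ℤ)

/-! ### Nests of osculating lattice paths -/

/-- A south step in the grid of the `m * n` points `(i, j)` (row, column). -/
def SouthStep {m n : ℕ} (u v : Fin m × Fin n) : Prop := v.1.val = u.1.val + 1 ∧ v.2 = u.2

/-- An east step in the grid. -/
def EastStep {m n : ℕ} (u v : Fin m × Fin n) : Prop := v.1 = u.1 ∧ v.2.val = u.2.val + 1

/-- Lattice paths with south and east steps (possibly of length zero), given by the list of the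
points that they visit, from the left side of the grid to its bottom. -/
structure IsNestPath {m n : ℕ} (p : List (Fin m × Fin n)) : Prop where
  steps : p.IsChain fun u v => SouthStep u v ∨ EastStep u v
  start : ∃ v ∈ p.head?, v.2.val = 0
  finish : ∃ v ∈ p.getLast?, v.1.val + 1 = m

/-- The path `p` has a corner at `v`: a south step into `v` followed by an east step. -/
def IsCorner {m n : ℕ} (p : List (Fin m × Fin n)) (v : Fin m × Fin n) : Prop :=
  ∃ u w, [u, v, w] <:+: p ∧ SouthStep u v ∧ EastStep v w

/-- Two paths osculate: they have no step in common, and every common point is a corner of one of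
them. At such a point the one path enters from the north and leaves to the east, so that the other
one comes from the west (or starts there, on the left side) and leaves to the south (or ends there,
on the bottom). Hence the paths touch there without crossing. -/
def Osculate {m n : ℕ} (p q : List (Fin m × Fin n)) : Prop :=
  (∀ u v, ¬([u, v] <:+: p ∧ [u, v] <:+: q)) ∧ ∀ v, v ∈ p → v ∈ q → IsCorner p v ∨ IsCorner q v

/-- `(m, n)`-nests of osculating paths. -/
structure IsNest {m n : ℕ} (N : Set (List (Fin m × Fin n))) : Prop where
  path : ∀ p ∈ N, IsNestPath p
  osculate : ∀ p ∈ N, ∀ q ∈ N, p ≠ q → Osculate p q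

/-- The set of `(m, n)`-nests of osculating paths. -/
def Nests (m n : ℕ) : Set (Set (List (Fin m × Fin n))) := {N | IsNest N}

/-- The horizontal edge just to the left of column `j` in row `i` is used: the entries of row `i`
from column `j` on have sum `1` (for a partial alternating sign matrix: the first nonzero entry to
the right of this edge is `1`). For `j = 0` the edge enters the grid, for `j = n` it leaves it. -/
def UsesWestEdge {m n : ℕ} (M : Matrix (Fin m) (Fin n) ℤ) (i : Fin m) (j : ℕ) : Prop :=
  ∑ j' : Fin n with j ≤ j'.val, M i j' = 1

/-- The vertical edge just above row `i` in column `j` is used: the entries of column `j` above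
row `i` have sum `1`. -/
def UsesNorthEdge {m n : ℕ} (M : Matrix (Fin m) (Fin n) ℤ) (i : ℕ) (j : Fin n) : Prop :=
  ∑ i' : Fin m with i'.val < i, M i' j = 1

/-- The nest of paths of a matrix. A path starts in every row whose sum is `1`. From a point `v`
it goes east if the edge to the east is used, except that a path which did not enter `v` from the
north must not go east if the edge to the north of `v` is used (then another path comes in there,
and the two paths touch at `v`). Otherwise it goes south, or it ends if `v` is on the bottom. -/
def pasmToNest {m n : ℕ} (M : Matrix (Fin m) (Fin n) ℤ) : Set (List (Fin m × Fin n)) :=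
  {p | IsNestPath p ∧ (∀ v ∈ p.head?, UsesWestEdge M v.1 0) ∧
    ∀ v ∈ p, (∃ w, [v, w] <:+: p ∧ EastStep v w) ↔
      (UsesWestEdge M v.1 (v.2.val + 1) ∧
        ((∃ u, [u, v] <:+: p ∧ SouthStep u v) ∨ ¬UsesNorthEdge M v.1.val v.2))}

end PartialASM

/-!
All seven families are encodings of one object: a `0`-`1` flow on the edges of the `m × n` grid,
where each entry of the matrix is a vertex and flow comes in from the left, leaves at the bottom,
and does not pass through the top or the right side.

A matrix `M` is a partial alternating sign matrix exactly if all its row sums from the right and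
all its column sums from the top are `0` or `1` (`isPASM_iff`). These sums are the flow on the
edges, and every flow arises in this way (`exists_mem_PASM_of_flow`). The potential of the flow is
the corner sum, so `M` may also be prescribed by its corner sums (`exists_mem_PASM_of_cornerSum`):
up to a reflection of the columns, they are the functions that vanish on the first row and column
and grow by `0` or `1` at each step, called depth functions here (`IsDepth`).

* Height functions are the `i + j - 2 t i j` with `t` a depth function
  (`IsPartialHeightFunction.exists_isDepth`); nonnegativity is automatic from the boundary values.
* The number of elements of an order ideal on the vertical lines is a depth function: each
  vertical line of an ideal is an initial segment, and the four kinds of covering relations say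
  that the numbers of neighboring lines differ by `0` or `1` in the right direction
  (`idealDepth_le_add`).
* A row of a triangle is determined by the numbers of its entries `≥ c` for `c ≥ 1`. For the
  triangle of `M` these are corner sums (`tailCount_pasmToTriangle`). Interlacing says that the
  counts of consecutive rows differ by `0` or `1`, and strictness that the counts for `c`
  and `c + 1` do.
* An edge of a fully-packed loop configuration records, depending on parity, whether the depth
  function grows across that edge. Degree two at a vertex says that the steps around the vertex
  add up to zero (`add_eq_two_iff`). Ice configurations correspond to these by orienting the edges
  according to parity, as each internal vertex has four neighbors.
* A nest uses an edge of the grid if one of its paths does, and this is a flow as at most two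
  paths meet at a point, touching there (`IsNest.touch`, `IsNest.conserve`). Conversely, if the
  edges at a point are all used, then the rule of `pasmToNest` sends the path from the north to
  the east and the path from the west to the south. So the paths of the nest of `M` can be traced
  back uniquely (`eq_of_mem_pasmToNest`), which makes them osculate, and tracing back from any
  edge with flow `1` shows that it lies on a path (`exists_mem_pasmToNest`). A path with a given
  start is determined by the rule, so that the nest is recovered from its edges.
-/

namespace PartialASM

variable {m n : ℕ}

/-! ### Alternating sequences and partial sums -/

/-- The sum of the entries of `f` with index less than `k`. -/
def prefixSum {n : ℕ} (f : Fin n → ℤ) (k : ℕ) : ℤ := ∑ i : Fin n with i.val < k, f i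

/-- The sum of the entries of `f` with index at least `k`. -/
def suffixSum {n : ℕ} (f : Fin n → ℤ) (k : ℕ) : ℤ := ∑ i : Fin n with k ≤ i.val, f i

theorem prefixSum_zero {n : ℕ} (f : Fin n → ℤ) : prefixSum f 0 = 0 := by
  simp [prefixSum]

theorem prefixSum_succ {n : ℕ} (f : Fin n → ℤ) (i : Fin n) :
    prefixSum f (i.val + 1) = prefixSum f i.val + f i := by
  have h : (Finset.univ.filter fun l : Fin n => l.val < i.val + 1) =
      insert i (Finset.univ.filter fun l : Fin n => l.val < i.val) := by
    ext l
    simp only [Finset.mem_filter, Finset.mem_univ, true_and, Finset.mem_insert, Fin.ext_iff]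
    omega
  rw [prefixSum, h, Finset.sum_insert (by simp), prefixSum, add_comm]

theorem prefixSum_of_le {n : ℕ} (f : Fin n → ℤ) {k : ℕ} (hk : n ≤ k) :
    prefixSum f k = ∑ i, f i := by
  rw [prefixSum, Finset.filter_true_of_mem]
  intro i _
  omega

theorem suffixSum_of_le {n : ℕ} (f : Fin n → ℤ) {k : ℕ} (hk : n ≤ k) : suffixSum f k = 0 := by
  rw [suffixSum, Finset.filter_false_of_mem, Finset.sum_empty]
  intro i _
  omega

theorem suffixSum_eq_add {n : ℕ} (f : Fin n → ℤ) (i : Fin n) :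
    suffixSum f i.val = f i + suffixSum f (i.val + 1) := by
  have h : (Finset.univ.filter fun l : Fin n => i.val ≤ l.val) =
      insert i (Finset.univ.filter fun l : Fin n => i.val + 1 ≤ l.val) := by
    ext l
    simp only [Finset.mem_filter, Finset.mem_univ, true_and, Finset.mem_insert, Fin.ext_iff]
    omega
  rw [suffixSum, h, Finset.sum_insert (by simp), suffixSum]

theorem prefixSum_comp_rev {n : ℕ} (f : Fin n → ℤ) (k : ℕ) :
    prefixSum (f ∘ Fin.rev) k = suffixSum f (n - k) := by
  rw [prefixSum, suffixSum]
  refine Finset.sum_equiv Fin.revPerm (fun i => ?_) (fun i _ => rfl)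
  simp only [Finset.mem_filter, Finset.mem_univ, true_and, Fin.revPerm_apply, Fin.val_rev]
  omega

/-- `f` has entries in `{-1, 0, 1}`, its sum is `0` or `1`, its nonzero entries alternate in sign,
and the first of them is `1`. -/
structure IsAlternating {n : ℕ} (f : Fin n → ℤ) : Prop where
  entries : ∀ i, f i = -1 ∨ f i = 0 ∨ f i = 1
  sum : ∑ i, f i = 0 ∨ ∑ i, f i = 1
  alternates : ∀ i i', i < i' → f i ≠ 0 → f i' ≠ 0 → (∀ l, i < l → l < i' → f l = 0) → f i' = -f i
  first : ∀ i, f i ≠ 0 → (∀ i', i' < i → f i' = 0) → f i = 1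

/-- The partial sums of an alternating sequence are `0` or `1`. For the induction, the last nonzero
entry has to be known as well: it is `1` if the partial sum is `1`, and `-1` (or absent) if the
partial sum is `0`. -/
theorem IsAlternating.prefixSum_eq {n : ℕ} {f : Fin n → ℤ} (hf : IsAlternating f) (k : ℕ) :
    (prefixSum f k = 0 ∧ ((∀ l : Fin n, l.val < k → f l = 0) ∨
      ∃ l : Fin n, l.val < k ∧ f l = -1 ∧ ∀ l' : Fin n, l < l' → l'.val < k → f l' = 0)) ∨
    (prefixSum f k = 1 ∧
      ∃ l : Fin n, l.val < k ∧ f l = 1 ∧ ∀ l' : Fin n, l < l' → l'.val < k → f l' = 0) := by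
  induction k with
  | zero => exact Or.inl ⟨prefixSum_zero f, Or.inl fun l hl => absurd hl (by omega)⟩
  | succ k ih =>
    by_cases hk : n ≤ k
    · rw [prefixSum_of_le f hk] at ih
      rw [prefixSum_of_le f (by omega : n ≤ k + 1)]
      rcases ih with ⟨h0, h | ⟨l, hl, hl1, hl2⟩⟩ | ⟨h1, l, hl, hl1, hl2⟩
      · exact Or.inl ⟨h0, Or.inl fun l _ => h l (by omega)⟩
      · exact Or.inl ⟨h0, Or.inr ⟨l, by omega, hl1, fun l' h _ => hl2 l' h (by omega)⟩⟩
      · exact Or.inr ⟨h1, l, by omega, hl1, fun l' h _ => hl2 l' h (by omega)⟩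
    · have hs := prefixSum_succ f ⟨k, by omega⟩
      simp only at hs
      rw [hs]
      set x : Fin n := ⟨k, by omega⟩ with hx
      have hlt : ∀ l : Fin n, l.val < k + 1 → l.val < k ∨ l = x := by
        intro l hl
        rw [hx, Fin.ext_iff]
        simp only
        omega
      by_cases hfx : f x = 0
      · rw [hfx, add_zero]
        have ext' : ∀ (P : Fin n → Prop), (∀ l : Fin n, P l → l.val < k → f l = 0) →
            ∀ l : Fin n, P l → l.val < k + 1 → f l = 0 := by
          intro P hP l hl hlk
          rcases hlt l hlk with h | rfl
          · exact hP l hl h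
          · exact hfx
        rcases ih with ⟨h0, h | ⟨l, hl, hl1, hl2⟩⟩ | ⟨h1, l, hl, hl1, hl2⟩
        · exact Or.inl ⟨h0, Or.inl fun l => ext' (fun _ => True) (fun l _ => h l) l trivial⟩
        · exact Or.inl ⟨h0, Or.inr ⟨l, by omega, hl1, ext' _ hl2⟩⟩
        · exact Or.inr ⟨h1, l, by omega, hl1, ext' _ hl2⟩
      · have last : ∀ l' : Fin n, x < l' → l'.val < k + 1 → f l' = 0 := by
          intro l' h h'
          rw [Fin.lt_def] at h
          simp only [hx] at h
          omega
        have btw : ∀ l : Fin n, (∀ l' : Fin n, l < l' → l'.val < k → f l' = 0) →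
            ∀ l', l < l' → l' < x → f l' = 0 := fun l h l' h1 h2 => h l' h1 h2
        rcases ih with ⟨h0, h | ⟨l, hl, hl1, hl2⟩⟩ | ⟨h1, l, hl, hl1, hl2⟩
        · have := hf.first x hfx fun i' hi' => h i' hi'
          exact Or.inr ⟨by omega, x, by simp [hx], this, last⟩
        · have := hf.alternates l x hl (by omega) hfx (btw l hl2)
          exact Or.inr ⟨by omega, x, by simp [hx], by omega, last⟩
        · have := hf.alternates l x hl (by omega) hfx (btw l hl2)
          exact Or.inl ⟨by omega, Or.inr ⟨x, by simp [hx], by omega, last⟩⟩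

theorem prefixSum_eq_of_forall_eq_zero {n : ℕ} (f : Fin n → ℤ) {a b : ℕ} (hab : a ≤ b)
    (h : ∀ l : Fin n, a ≤ l.val → l.val < b → f l = 0) : prefixSum f b = prefixSum f a := by
  induction b, hab using Nat.le_induction with
  | base => rfl
  | succ b hab ih =>
    rw [← ih fun l h1 h2 => h l h1 (by omega)]
    by_cases hb : n ≤ b
    · rw [prefixSum_of_le f hb, prefixSum_of_le f (by omega)]
    · have := prefixSum_succ f ⟨b, by omega⟩
      simp only at this
      rw [this, h ⟨b, by omega⟩ hab (by simp), add_zero]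

theorem isAlternating_iff {n : ℕ} (f : Fin n → ℤ) :
    IsAlternating f ↔ ∀ k, prefixSum f k = 0 ∨ prefixSum f k = 1 := by
  refine ⟨fun hf k => ?_, fun h => ⟨fun i => ?_, ?_, fun i i' hi h1 h2 hz => ?_, fun i hi hz => ?_⟩⟩
  · rcases hf.prefixSum_eq k with h | h
    · exact Or.inl h.1
    · exact Or.inr h.1
  · have := prefixSum_succ f i
    have := h i
    have := h (i + 1)
    omega
  · simpa [prefixSum_of_le f le_rfl] using h n
  · have e1 := prefixSum_succ f i
    have e2 := prefixSum_succ f i'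
    have e3 := prefixSum_eq_of_forall_eq_zero f (a := i + 1) (b := i') hi
      fun l h1 h2 => hz l h1 h2
    have := h i
    have := h (i + 1)
    have := h (i' + 1)
    omega
  · have e1 := prefixSum_succ f i
    have e3 := prefixSum_eq_of_forall_eq_zero f (a := 0) (b := i) (by omega)
      fun l _ h2 => hz l h2
    rw [prefixSum_zero] at e3
    have := h (i + 1)
    omega

theorem isPASM_iff_isAlternating (M : Matrix (Fin m) (Fin n) ℤ) :
    IsPASM M ↔ (∀ i, IsAlternating (M i ∘ Fin.rev)) ∧ ∀ j, IsAlternating fun i => M i j := by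
  have hsum : ∀ i, ∑ j, (M i ∘ Fin.rev) j = ∑ j, M i j :=
    fun i => Equiv.sum_comp Fin.revPerm (M i)
  constructor
  · intro h
    refine ⟨fun i => ⟨fun j => h.entries i _, ?_, fun j j' hj h1 h2 hz => ?_, fun j hj hz => ?_⟩,
      fun j => ⟨fun i => h.entries i j, h.col_sum j, h.col_alternates j,
        fun i => h.col_first i j⟩⟩
    · rw [hsum]
      exact h.row_sum i
    · have := h.row_alternates i j'.rev j.rev (Fin.rev_lt_rev.2 hj) h2 h1 fun l hl hl' => by
        have := hz l.rev (Fin.lt_rev_iff.1 hl') (Fin.rev_lt_iff.1 hl)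
        simpa using this
      simp only [Function.comp_apply]
      omega
    · refine h.row_last i j.rev hj fun j' hj' => ?_
      have := hz j'.rev (Fin.rev_lt_iff.1 hj')
      simpa using this
  · rintro ⟨hr, hc⟩
    have hr' : ∀ i j, M i j = (M i ∘ Fin.rev) j.rev := fun i j => by simp
    refine ⟨fun i j => (hc j).entries i, fun i => ?_, fun j => (hc j).sum,
      fun i j j' hj h1 h2 hz => ?_, fun j => (hc j).alternates, fun i j => (hc j).first i,
      fun i j hj hz => ?_⟩
    · have := (hr i).sum
      rwa [hsum] at this
    · rw [hr'] at h1 h2 ⊢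
      rw [hr' i j]
      have := (hr i).alternates j'.rev j.rev (Fin.rev_lt_rev.2 hj) h2 h1 fun l hl hl' =>
        hz l.rev (Fin.lt_rev_iff.1 hl') (Fin.rev_lt_iff.1 hl)
      omega
    · rw [hr'] at hj ⊢
      exact (hr i).first j.rev hj fun j' hj' => hz j'.rev (Fin.lt_rev_iff.1 hj')

/-- A matrix is a partial alternating sign matrix exactly if all partial sums of its rows from the
right and of its columns from the top are `0` or `1`. -/
theorem isPASM_iff (M : Matrix (Fin m) (Fin n) ℤ) :
    IsPASM M ↔ (∀ i k, suffixSum (M i) k = 0 ∨ suffixSum (M i) k = 1) ∧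
      ∀ j k, prefixSum (fun i => M i j) k = 0 ∨ prefixSum (fun i => M i j) k = 1 := by
  simp only [isPASM_iff_isAlternating, isAlternating_iff, prefixSum_comp_rev]
  refine and_congr_left fun _ => forall_congr' fun i => ⟨fun h k => ?_, fun h k => h _⟩
  by_cases hk : n ≤ k
  · exact Or.inl (suffixSum_of_le _ hk)
  · have := h (n - k)
    rwa [Nat.sub_sub_self (by omega)] at this

theorem eq_of_suffixSum_eq {M M' : Matrix (Fin m) (Fin n) ℤ}
    (h : ∀ i, ∀ j : Fin n, suffixSum (M i) j = suffixSum (M' i) j) : M = M' := by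
  ext i j
  have key : ∀ k, suffixSum (M i) k = suffixSum (M' i) k := by
    intro k
    by_cases hk : n ≤ k
    · rw [suffixSum_of_le _ hk, suffixSum_of_le _ hk]
    · exact h i ⟨k, by omega⟩
  have e1 := suffixSum_eq_add (M i) j
  have e2 := suffixSum_eq_add (M' i) j
  rw [key, key] at e1
  omega

/-- A partial alternating sign matrix can be prescribed by the partial sums of its rows and columns.
The condition on `R` and `C` is that of a flow on the edges of the grid, where `R i j` is the flow
on the edge to the left of the entry `(i, j)` and `C i j` that on the edge above it. -/
theorem exists_mem_PASM_of_flow (R : Fin m → ℕ → ℤ) (C : ℕ → Fin n → ℤ)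
    (hR0 : ∀ i, R i n = 0) (hC0 : ∀ j, C 0 j = 0)
    (flow : ∀ (i : Fin m) (j : Fin n), R i j + C i j = R i (j + 1) + C (i + 1) j)
    (hR : ∀ i, ∀ j ≤ n, R i j = 0 ∨ R i j = 1) (hC : ∀ j, ∀ i ≤ m, C i j = 0 ∨ C i j = 1) :
    ∃ M ∈ PASM m n, (∀ i, ∀ j ≤ n, suffixSum (M i) j = R i j) ∧
      ∀ j, ∀ i ≤ m, prefixSum (fun i' => M i' j) i = C i j := by
  let M : Matrix (Fin m) (Fin n) ℤ := fun i j => R i j - R i (j + 1)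
  have h1 : ∀ i, ∀ j ≤ n, suffixSum (M i) j = R i j := by
    intro i j hj
    induction hj using Nat.decreasingInduction with
    | self => rw [hR0, suffixSum_of_le _ le_rfl]
    | @of_succ j hj ih =>
      have := suffixSum_eq_add (M i) ⟨j, hj⟩
      simp only [ih, M] at this
      simp only [M]
      omega
  have h2 : ∀ j, ∀ i ≤ m, prefixSum (fun i' => M i' j) i = C i j := by
    intro j i hi
    induction i with
    | zero => rw [hC0, prefixSum_zero]
    | succ i ih =>
      have e1 := prefixSum_succ (fun i' => M i' j) ⟨i, by omega⟩
      have e2 := flow ⟨i, by omega⟩ j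
      simp only [ih (by omega), M] at e1 e2
      simp only [M]
      omega
  refine ⟨M, (isPASM_iff M).2 ⟨fun i k => ?_, fun j k => ?_⟩, h1, h2⟩
  · by_cases hk : n ≤ k
    · exact Or.inl (suffixSum_of_le _ hk)
    · rw [h1 i k (by omega)]
      exact hR i k (by omega)
  · by_cases hk : k ≤ m
    · rw [h2 j k hk]
      exact hC j k hk
    · rw [prefixSum_of_le _ (by omega : m ≤ k), ← prefixSum_of_le _ le_rfl, h2 j m le_rfl]
      exact hC j m le_rfl

/-! ### Corner sums -/

theorem cornerSum_zero (M : Matrix (Fin m) (Fin n) ℤ) (j : ℕ) : cornerSum M 0 j = 0 := by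
  simp [cornerSum]

theorem cornerSum_of_le (M : Matrix (Fin m) (Fin n) ℤ) (i : ℕ) {j : ℕ} (hj : n ≤ j) :
    cornerSum M i j = 0 :=
  Finset.sum_eq_zero fun i' _ => suffixSum_of_le (M i') hj

theorem cornerSum_succ (M : Matrix (Fin m) (Fin n) ℤ) (i : Fin m) (j : ℕ) :
    cornerSum M (i + 1) j = cornerSum M i j + suffixSum (M i) j :=
  prefixSum_succ (fun i' => suffixSum (M i') j) i

theorem cornerSum_eq_add (M : Matrix (Fin m) (Fin n) ℤ) (i : ℕ) (j : Fin n) :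
    cornerSum M i j = prefixSum (fun i' => M i' j) i + cornerSum M i (j + 1) := by
  rw [cornerSum, prefixSum, cornerSum, ← Finset.sum_add_distrib]
  exact Finset.sum_congr rfl fun i' _ => suffixSum_eq_add (M i') j

theorem eq_of_cornerSum_eq {M M' : Matrix (Fin m) (Fin n) ℤ}
    (h : ∀ i ≤ m, ∀ j ≤ n, cornerSum M i j = cornerSum M' i j) : M = M' := by
  refine eq_of_suffixSum_eq fun i j => ?_
  have e1 := cornerSum_succ M i j
  have e2 := cornerSum_succ M' i j
  rw [h _ (by omega) _ (by omega), h _ (by omega) _ (by omega)] at e1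
  omega

/-- A partial alternating sign matrix can be prescribed by its corner sums. -/
theorem exists_mem_PASM_of_cornerSum (c : ℕ → ℕ → ℤ) (h0 : ∀ j ≤ n, c 0 j = 0)
    (hn : ∀ i ≤ m, c i n = 0)
    (hrow : ∀ i < m, ∀ j ≤ n, c (i + 1) j = c i j ∨ c (i + 1) j = c i j + 1)
    (hcol : ∀ i ≤ m, ∀ j < n, c i j = c i (j + 1) ∨ c i j = c i (j + 1) + 1) :
    ∃ M ∈ PASM m n, ∀ i ≤ m, ∀ j ≤ n, cornerSum M i j = c i j := by
  obtain ⟨M, hM, hR, -⟩ := exists_mem_PASM_of_flow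
    (fun (i : Fin m) j => c (i + 1) j - c i j) (fun i (j : Fin n) => c i j - c i (j + 1))
    (fun i => by simp only [hn _ i.isLt, hn _ i.isLt.le, sub_self])
    (fun j => by simp only [h0 _ j.isLt, h0 _ j.isLt.le, sub_self])
    (fun i j => by ring)
    (fun i j hj => by have := hrow i i.isLt j hj; omega)
    (fun j i hi => by have := hcol i hi j j.isLt; omega)
  refine ⟨M, hM, fun i hi j hj => ?_⟩
  induction i with
  | zero => rw [cornerSum_zero, h0 j hj]
  | succ i ih =>
    have := cornerSum_succ M ⟨i, hi⟩ j
    rw [hR _ j hj] at this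
    simp only [ih (by omega)] at this
    omega

/-! ### Depth functions -/

/-- `t i j`, `0 ≤ i ≤ m`, `0 ≤ j ≤ n`, vanishes for `i = 0` and for `j = 0`, and increases by `0` or
`1` at each step to the right or down. Height-function matrices are the `i + j - 2 t i j`. -/
structure IsDepth (m n : ℕ) (t : ℕ → ℕ → ℤ) : Prop where
  first_row : ∀ j ≤ n, t 0 j = 0
  first_col : ∀ i ≤ m, t i 0 = 0
  row_step : ∀ i ≤ m, ∀ j < n, t i (j + 1) = t i j ∨ t i (j + 1) = t i j + 1
  col_step : ∀ i < m, ∀ j ≤ n, t (i + 1) j = t i j ∨ t (i + 1) j = t i j + 1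

theorem IsDepth.bounds {t : ℕ → ℕ → ℤ} (ht : IsDepth m n t) {i j : ℕ} (hi : i ≤ m) (hj : j ≤ n) :
    0 ≤ t i j ∧ t i j ≤ i ∧ t i j ≤ j := by
  have h1 : 0 ≤ t i j ∧ t i j ≤ i := by
    induction i with
    | zero => simp [ht.first_row j hj]
    | succ i ih =>
      have := ih (by omega)
      have := ht.col_step i hi j hj
      push_cast
      omega
  refine ⟨h1.1, h1.2, ?_⟩
  clear h1
  induction j with
  | zero => simp [ht.first_col i hi]
  | succ j ih =>
    have := ih (by omega)
    have := ht.row_step i hi j hj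
    push_cast
    omega

theorem IsDepth.isPartialHeightFunction {t : ℕ → ℕ → ℤ} (ht : IsDepth m n t)
    {h : Matrix (Fin (m + 1)) (Fin (n + 1)) ℤ} (hh : ∀ i j, h i j = i.val + j.val - 2 * t i j) :
    IsPartialHeightFunction h where
  nonneg i j := by
    have := ht.bounds (Nat.lt_succ_iff.1 i.isLt) (Nat.lt_succ_iff.1 j.isLt)
    rw [hh]
    omega
  first_row k := by
    rw [hh, Fin.val_zero, ht.first_row _ (by omega)]
    simp
  first_col l := by
    rw [hh, Fin.val_zero, ht.first_col _ (by omega)]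
    simp
  row_adjacent i j := by
    have := ht.row_step i (by omega) j j.isLt
    rw [hh, hh, Fin.val_succ, Fin.val_castSucc, abs_eq zero_le_one]
    push_cast
    omega
  col_adjacent i j := by
    have := ht.col_step i i.isLt j (by omega)
    rw [hh, hh, Fin.val_succ, Fin.val_castSucc, abs_eq zero_le_one]
    push_cast
    omega

theorem IsPartialHeightFunction.emod_two {h : Matrix (Fin (m + 1)) (Fin (n + 1)) ℤ}
    (hh : IsPartialHeightFunction h) (i : Fin (m + 1)) (j : Fin (n + 1)) :
    h i j % 2 = (i.val + j.val : ℤ) % 2 := by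
  induction i using Fin.induction with
  | zero => simp [hh.first_row]
  | succ i ih =>
    have := hh.col_adjacent i j
    rw [abs_eq zero_le_one] at this
    rw [Fin.val_castSucc] at ih
    rw [Fin.val_succ]
    push_cast
    omega

theorem IsPartialHeightFunction.exists_isDepth {h : Matrix (Fin (m + 1)) (Fin (n + 1)) ℤ}
    (hh : IsPartialHeightFunction h) :
    ∃ t, IsDepth m n t ∧ ∀ i j, h i j = i.val + j.val - 2 * t i j := by
  obtain ⟨t, key⟩ : ∃ t : ℕ → ℕ → ℤ, ∀ i j, h i j = i.val + j.val - 2 * t i j := by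
    refine ⟨fun i j => (i + j - h (Fin.ofNat (m + 1) i) (Fin.ofNat (n + 1) j)) / 2, fun i j => ?_⟩
    have := hh.emod_two i j
    simp only [Fin.ofNat_val_eq_self]
    omega
  refine ⟨t, ⟨fun j hj => ?_, fun i hi => ?_, fun i hi j hj => ?_, fun i hi j hj => ?_⟩, key⟩
  · have e := key 0 ⟨j, by omega⟩
    rw [hh.first_row, Fin.val_zero] at e
    simp only at e
    omega
  · have e := key ⟨i, by omega⟩ 0
    rw [hh.first_col, Fin.val_zero] at e
    simp only at e
    omega
  · have e := hh.row_adjacent ⟨i, by omega⟩ ⟨j, hj⟩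
    rw [abs_eq zero_le_one, key, key, Fin.val_succ, Fin.val_castSucc] at e
    push_cast at e
    omega
  · have e := hh.col_adjacent ⟨i, hi⟩ ⟨j, by omega⟩
    rw [abs_eq zero_le_one, key, key, Fin.val_succ, Fin.val_castSucc] at e
    push_cast at e
    omega

/-! ### From matrices to height functions -/

theorem isDepth_cornerSum {M : Matrix (Fin m) (Fin n) ℤ} (hM : IsPASM M) :
    IsDepth m n fun i j => cornerSum M i (n - j) where
  first_row j _ := cornerSum_zero M _
  first_col i _ := cornerSum_of_le M i (by omega)
  row_step i hi j hj := by
    have e := cornerSum_eq_add M i ⟨n - (j + 1), by omega⟩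
    have := ((isPASM_iff M).1 hM).2 ⟨n - (j + 1), by omega⟩ i
    simp only [show n - (j + 1) + 1 = n - j by omega] at e
    omega
  col_step i hi j hj := by
    have e := cornerSum_succ M ⟨i, hi⟩ (n - j)
    have := ((isPASM_iff M).1 hM).1 ⟨i, hi⟩ (n - j)
    simp only at e
    omega

theorem bijOn_pasmToHeight : Set.BijOn pasmToHeight (PASM m n) (PartialHeightFunctions m n) := by
  refine ⟨fun M hM => (isDepth_cornerSum hM).isPartialHeightFunction fun _ _ => rfl,
    fun M _ M' _ h => eq_of_cornerSum_eq fun i hi j hj => ?_, fun h hh => ?_⟩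
  · have := congrFun (congrFun h ⟨i, by omega⟩) ⟨n - j, by omega⟩
    simp only [pasmToHeight, Nat.sub_sub_self hj] at this
    omega
  · obtain ⟨t, ht, hht⟩ := hh.exists_isDepth
    obtain ⟨M, hM, hMc⟩ := exists_mem_PASM_of_cornerSum (m := m) (n := n)
      (fun i j => t i (n - j)) (fun j _ => ht.first_row _ (by omega))
      (fun i hi => by simpa using ht.first_col i hi)
      (fun i hi j hj => ht.col_step i hi _ (by omega))
      (fun i hi j hj => by
        have := ht.row_step i hi (n - (j + 1)) (by omega)
        rwa [show n - (j + 1) + 1 = n - j by omega] at this)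
    refine ⟨M, hM, ?_⟩
    ext i j
    rw [hht, pasmToHeight, hMc i (by omega) _ (by omega), Nat.sub_sub_self (by omega)]

/-! ### From order ideals to height functions -/

/-- The number of elements of the order ideal `I` on the vertical line over `(i - 1, j - 1)`. -/
noncomputable def idealDepth (I : LowerSet (PASMPoset m n)) (i j : ℕ) : ℕ :=
  {x : PASMPoset m n | x ∈ I ∧ x.i = (i : ℤ) - 1 ∧ x.j = (j : ℤ) - 1}.ncard

theorem PASMPoset.CoveredBy.mem {I : LowerSet (PASMPoset m n)} {x y : PASMPoset m n}
    (h : x.CoveredBy y) (hy : y ∈ I) : x ∈ I :=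
  I.lower (Relation.ReflTransGen.single h) hy

/-- An order ideal is closed under going down vertically, as `(i, j, k - 1)` lies below
`(i - 1, j, k - 1)`, which lies below `(i, j, k)`. -/
theorem mem_of_mem_of_k_le {I : LowerSet (PASMPoset m n)} {x y : PASMPoset m n} (hx : x ∈ I)
    (hi : y.i = x.i) (hj : y.j = x.j) (hk : y.k ≤ x.k) : y ∈ I := by
  obtain ⟨d, hd⟩ : ∃ d : ℕ, x.k = y.k + d := ⟨(x.k - y.k).toNat, by omega⟩
  induction d generalizing x with
  | zero =>
    have : y = x := PASMPoset.ext hi hj (by omega)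
    rwa [this]
  | succ d ih =>
    obtain ⟨a, b, c, h1, h2, h3, h4, h5, h6⟩ := x
    have := y.k_nonneg
    simp only at hi hj hd
    have hz : (⟨a - 1, b, c - 1, by omega, by omega, by omega, h4, by omega, by omega⟩ :
        PASMPoset m n) ∈ I :=
      PASMPoset.CoveredBy.mem (y := ⟨a, b, c, h1, h2, h3, h4, h5, h6⟩)
        (Or.inr (Or.inr (Or.inl ⟨rfl, rfl, rfl⟩))) hx
    have hw : (⟨a, b, c - 1, by omega, by omega, by omega, h4, by omega, by omega⟩ :
        PASMPoset m n) ∈ I :=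
      PASMPoset.CoveredBy.mem (y := ⟨a - 1, b, c - 1, by omega, by omega, by omega, h4, by omega,
        by omega⟩) (Or.inl ⟨by simp, rfl, rfl⟩) hz
    exact ih hw hi hj (by simp only; omega) (by simp only; omega)

theorem ncard_line {i j t : ℕ} (hi : i ≤ m) (hj : j ≤ n) (hti : t ≤ i) (htj : t ≤ j) :
    {x : PASMPoset m n | x.k < t ∧ x.i = (i : ℤ) - 1 ∧ x.j = (j : ℤ) - 1}.ncard = t := by
  have hinj : Set.InjOn (fun x : PASMPoset m n => x.k.toNat)
      {x : PASMPoset m n | x.k < t ∧ x.i = (i : ℤ) - 1 ∧ x.j = (j : ℤ) - 1} := by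
    rintro x ⟨-, hx1, hx2⟩ y ⟨-, hy1, hy2⟩ hxy
    have := x.k_nonneg
    have := y.k_nonneg
    simp only at hxy
    exact PASMPoset.ext (by omega) (by omega) (by omega)
  rw [← hinj.ncard_image]
  have : (fun x : PASMPoset m n => x.k.toNat) ''
      {x : PASMPoset m n | x.k < t ∧ x.i = (i : ℤ) - 1 ∧ x.j = (j : ℤ) - 1} =
      (Finset.range t : Set ℕ) := by
    ext k
    simp only [Set.mem_image, Set.mem_ofPred_eq, Finset.coe_range, Set.mem_Iio]
    constructor
    · rintro ⟨x, ⟨hx, -, -⟩, rfl⟩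
      have := x.k_nonneg
      omega
    · intro hk
      exact ⟨⟨i - 1, j - 1, k, by omega, by omega, by omega, by omega, by omega, by omega⟩,
        ⟨by simpa using hk, rfl, rfl⟩, by simp⟩
  rw [this, Set.ncard_coe_finset, Finset.card_range]

theorem idealDepth_spec (I : LowerSet (PASMPoset m n)) {i j : ℕ} (hi : i ≤ m) (hj : j ≤ n) :
    idealDepth I i j ≤ i ∧ idealDepth I i j ≤ j ∧
      ∀ x : PASMPoset m n, x.i = (i : ℤ) - 1 → x.j = (j : ℤ) - 1 →
        (x ∈ I ↔ x.k < idealDepth I i j) := by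
  classical
  have hex : ∃ k : ℕ, min i j ≤ k ∨
      ∀ x : PASMPoset m n, x.i = (i : ℤ) - 1 → x.j = (j : ℤ) - 1 → x.k = k → x ∉ I :=
    ⟨min i j, Or.inl le_rfl⟩
  obtain ⟨t, htmin, hspec, ht⟩ : ∃ t : ℕ, t ≤ min i j ∧
      (min i j ≤ t ∨
        ∀ x : PASMPoset m n, x.i = (i : ℤ) - 1 → x.j = (j : ℤ) - 1 → x.k = t → x ∉ I) ∧
      ∀ k < t, ∃ x ∈ I, x.i = (i : ℤ) - 1 ∧ x.j = (j : ℤ) - 1 ∧ x.k = k := by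
    refine ⟨Nat.find hex, Nat.find_min' hex (Or.inl le_rfl), Nat.find_spec hex, fun k hk => ?_⟩
    have := Nat.find_min hex hk
    push Not at this
    obtain ⟨-, x, h1, h2, h3, h4⟩ := this
    exact ⟨x, h4, h1, h2, h3⟩
  have hmem : ∀ x : PASMPoset m n, x.i = (i : ℤ) - 1 → x.j = (j : ℤ) - 1 → (x ∈ I ↔ x.k < t) := by
    intro x hxi hxj
    have := x.k_nonneg
    have := x.k_le_i
    have := x.k_le_j
    constructor
    · intro hx
      by_contra hlt
      rcases hspec with h | h
      · omega
      · exact h ⟨x.i, x.j, t, by omega, by omega, by omega, x.j_le, by omega, x.i_le⟩ hxi hxj rfl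
          (mem_of_mem_of_k_le hx rfl rfl (by simp only; omega))
    · intro hx
      obtain ⟨y, hy, h1, h2, h3⟩ := ht x.k.toNat (by omega)
      have : x = y := PASMPoset.ext (by omega) (by omega) (by omega)
      rwa [this]
  have hcard : idealDepth I i j = t := by
    rw [idealDepth, ← ncard_line (t := t) hi hj (by omega) (by omega)]
    congr 1
    ext x
    simp only [Set.mem_ofPred_eq]
    exact ⟨fun h => ⟨(hmem x h.2.1 h.2.2).1 h.1, h.2⟩, fun h => ⟨(hmem x h.2.1 h.2.2).2 h.1, h.2⟩⟩
  rw [hcard]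
  exact ⟨by omega, by omega, hmem⟩

theorem idealDepth_le_add (I : LowerSet (PASMPoset m n)) {i j i' j' : ℕ} (d : ℕ) (hi : i ≤ m)
    (hj : j ≤ n) (hi' : i' ≤ m) (hj' : j' ≤ n) (hmin : min i j ≤ min i' j' + d)
    (hcov : ∀ x y : PASMPoset m n, x.i = (i' : ℤ) - 1 → x.j = (j' : ℤ) - 1 → y.i = (i : ℤ) - 1 →
      y.j = (j : ℤ) - 1 → x.k = y.k - d → x.CoveredBy y) :
    idealDepth I i j ≤ idealDepth I i' j' + d := by
  by_contra hlt
  obtain ⟨a1, a2, a3⟩ := idealDepth_spec I hi hj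
  obtain ⟨b1, b2, b3⟩ := idealDepth_spec I hi' hj'
  generalize idealDepth I i' j' = t at *
  have hy := (a3 ⟨i - 1, j - 1, t + d, by omega, by omega, by omega, by omega, by omega, by omega⟩
    rfl rfl).2 (by simp only; omega)
  have hx := (b3 ⟨i' - 1, j' - 1, t, by omega, by omega, by omega, by omega, by omega, by omega⟩
    rfl rfl).1 ((hcov _ _ rfl rfl rfl rfl (by simp)).mem hy)
  exact lt_irrefl _ hx

theorem isDepth_idealDepth (I : LowerSet (PASMPoset m n)) :
    IsDepth m n fun i j => idealDepth I i j where
  first_row j hj := by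
    have := (idealDepth_spec I (Nat.zero_le m) hj).1
    omega
  first_col i hi := by
    have := (idealDepth_spec I hi (Nat.zero_le n)).2.1
    omega
  row_step i hi j hj := by
    have h1 : idealDepth I i j ≤ idealDepth I i (j + 1) :=
      idealDepth_le_add I 0 hi hj.le hi hj (by omega) fun x y _ _ _ _ _ =>
        Or.inr (Or.inl (by omega))
    have h2 : idealDepth I i (j + 1) ≤ idealDepth I i j + 1 :=
      idealDepth_le_add I 1 hi hj hi hj.le (by omega) fun x y _ _ _ _ _ =>
        Or.inr (Or.inr (Or.inr (by omega)))
    omega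
  col_step i hi j hj := by
    have h1 : idealDepth I i j ≤ idealDepth I (i + 1) j :=
      idealDepth_le_add I 0 hi.le hj hi hj (by omega) fun x y _ _ _ _ _ =>
        Or.inl (by omega)
    have h2 : idealDepth I (i + 1) j ≤ idealDepth I i j + 1 :=
      idealDepth_le_add I 1 hi hj hi.le hj (by omega) fun x y _ _ _ _ _ =>
        Or.inr (Or.inr (Or.inl (by omega)))
    omega

/-- The order ideal whose vertical line over `(i, j)` has `t (i + 1) (j + 1)` elements. -/
def IsDepth.toLowerSet {t : ℕ → ℕ → ℤ} (ht : IsDepth m n t) : LowerSet (PASMPoset m n) where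
  carrier := {x | x.k < t (x.i.toNat + 1) (x.j.toNat + 1)}
  lower' := by
    intro y x hxy hy
    induction hxy using Relation.ReflTransGen.head_induction_on with
    | refl => exact hy
    | @head a c hac _ ih =>
      have hc : c.k < t (c.i.toNat + 1) (c.j.toNat + 1) := ih
      change a.k < t (a.i.toNat + 1) (a.j.toNat + 1)
      have ha := a.k_nonneg
      have hc0 := c.k_nonneg
      have := a.k_le_i
      have := a.k_le_j
      have := c.k_le_i
      have := c.k_le_j
      have := a.i_le
      have := a.j_le
      have := c.i_le
      have := c.j_le
      rcases hac with ⟨h1, h2, h3⟩ | ⟨h1, h2, h3⟩ | ⟨h1, h2, h3⟩ | ⟨h1, h2, h3⟩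
      · have := ht.col_step (c.i.toNat + 1) (by omega) (c.j.toNat + 1) (by omega)
        rw [show a.i.toNat = c.i.toNat + 1 by omega, h2]
        omega
      · have := ht.row_step (c.i.toNat + 1) (by omega) (c.j.toNat + 1) (by omega)
        rw [show a.j.toNat = c.j.toNat + 1 by omega, h1]
        omega
      · have := ht.col_step (a.i.toNat + 1) (by omega) (a.j.toNat + 1) (by omega)
        rw [show c.i.toNat = a.i.toNat + 1 by omega, ← h2] at hc
        omega
      · have := ht.row_step (a.i.toNat + 1) (by omega) (a.j.toNat + 1) (by omega)
        rw [show c.j.toNat = a.j.toNat + 1 by omega, ← h1] at hc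
        omega

theorem IsDepth.idealDepth_toLowerSet {t : ℕ → ℕ → ℤ} (ht : IsDepth m n t) {i j : ℕ} (hi : i ≤ m)
    (hj : j ≤ n) : (idealDepth ht.toLowerSet i j : ℤ) = t i j := by
  obtain ⟨h0, h1, h2⟩ := ht.bounds hi hj
  obtain ⟨s, hs⟩ := Int.eq_ofNat_of_zero_le h0
  rw [hs] at h1 h2 ⊢
  rw [Nat.cast_inj, idealDepth, ← ncard_line (t := s) hi hj (by omega) (by omega)]
  congr 1
  ext x
  simp only [Set.mem_ofPred_eq]
  refine and_congr_left fun ⟨hxi, hxj⟩ => ?_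
  have := x.k_nonneg
  have := x.k_le_i
  have := x.k_le_j
  rw [← hs]
  change x.k < t _ _ ↔ _
  rw [show x.i.toNat + 1 = i by omega, show x.j.toNat + 1 = j by omega]

theorem bijOn_idealToHeight :
    Set.BijOn idealToHeight (Set.univ : Set (LowerSet (PASMPoset m n)))
      (PartialHeightFunctions m n) := by
  refine ⟨fun I _ => (isDepth_idealDepth I).isPartialHeightFunction fun _ _ => rfl,
    fun I _ I' _ h => ?_, fun h hh => ?_⟩
  · ext x
    have := x.k_nonneg
    have := x.k_le_i
    have := x.k_le_j
    have := x.i_le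
    have := x.j_le
    have hi : x.i.toNat + 1 ≤ m := by omega
    have hj : x.j.toNat + 1 ≤ n := by omega
    have e : idealDepth I (x.i.toNat + 1) (x.j.toNat + 1) =
        idealDepth I' (x.i.toNat + 1) (x.j.toNat + 1) := by
      have := congrFun (congrFun h ⟨x.i.toNat + 1, by omega⟩) ⟨x.j.toNat + 1, by omega⟩
      simp only [idealToHeight] at this
      simp only [idealDepth]
      omega
    change x ∈ I ↔ x ∈ I'
    rw [(idealDepth_spec I hi hj).2.2 x (by omega) (by omega),
      (idealDepth_spec I' hi hj).2.2 x (by omega) (by omega), e]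
  · obtain ⟨t, ht, hht⟩ := hh.exists_isDepth
    refine ⟨ht.toLowerSet, Set.mem_univ _, ?_⟩
    ext i j
    rw [hht, ← ht.idealDepth_toLowerSet (by omega) (by omega)]
    rfl

/-! ### Lattice paths -/

/-- The path `p` has a south step into `v`. -/
def EntersNorth (p : List (Fin m × Fin n)) (v : Fin m × Fin n) : Prop :=
  ∃ u, [u, v] <:+: p ∧ SouthStep u v

/-- The path `p` has an east step out of `v`. -/
def LeavesEast (p : List (Fin m × Fin n)) (v : Fin m × Fin n) : Prop :=
  ∃ w, [v, w] <:+: p ∧ EastStep v w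

theorem pair_infix_iff {α : Type*} {u v : α} {p : List α} :
    [u, v] <:+: p ↔ ∃ k, p[k]? = some u ∧ p[k + 1]? = some v := by
  rw [List.infix_iff_getElem?]
  refine exists_congr fun k => ⟨fun h => ⟨?_, ?_⟩, fun h => ⟨?_, fun i hi => ?_⟩⟩
  · simpa using h.2 0 (by simp)
  · simpa [add_comm] using h.2 1 (by simp)
  · have := (List.getElem?_eq_some_iff.1 h.2).1
    simp only [List.length_cons, List.length_nil]
    omega
  · have : i = 0 ∨ i = 1 := by
      simp only [List.length_cons, List.length_nil] at hi
      omega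
    rcases this with rfl | rfl
    · simpa using h.1
    · simpa [add_comm] using h.2

theorem triple_infix_iff {α : Type*} {u v w : α} {p : List α} :
    [u, v, w] <:+: p ↔ ∃ k, p[k]? = some u ∧ p[k + 1]? = some v ∧ p[k + 2]? = some w := by
  rw [List.infix_iff_getElem?]
  refine exists_congr fun k => ⟨fun h => ⟨?_, ?_, ?_⟩, fun h => ⟨?_, fun i hi => ?_⟩⟩
  · simpa using h.2 0 (by simp)
  · simpa [add_comm] using h.2 1 (by simp)
  · simpa [add_comm] using h.2 2 (by simp)
  · have := (List.getElem?_eq_some_iff.1 h.2.2).1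
    simp only [List.length_cons, List.length_nil]
    omega
  · have : i = 0 ∨ i = 1 ∨ i = 2 := by
      simp only [List.length_cons, List.length_nil] at hi
      omega
    rcases this with rfl | rfl | rfl
    · simpa using h.1
    · simpa [add_comm] using h.2.1
    · simpa [add_comm] using h.2.2

theorem mem_of_pair_infix {α : Type*} {u v : α} {p : List α} (h : [u, v] <:+: p) :
    u ∈ p ∧ v ∈ p :=
  ⟨h.subset (by simp), h.subset (by simp)⟩

namespace IsNestPath

variable {p q : List (Fin m × Fin n)} {u v w : Fin m × Fin n}

theorem step (hp : IsNestPath p) (h : [u, v] <:+: p) : SouthStep u v ∨ EastStep u v := by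
  obtain ⟨k, h1, h2⟩ := pair_infix_iff.1 h
  obtain ⟨k1, rfl⟩ := List.getElem?_eq_some_iff.1 h1
  obtain ⟨k2, rfl⟩ := List.getElem?_eq_some_iff.1 h2
  exact List.isChain_iff_getElem.1 hp.steps k k2

theorem add_eq (hp : IsNestPath p) {k l : ℕ} (hu : p[k]? = some u) (hv : p[k + l]? = some v) :
    v.1.val + v.2.val = u.1.val + u.2.val + l := by
  induction l generalizing v with
  | zero =>
    have : v = u := by simpa using hv.symm.trans hu
    rw [this, add_zero]
  | succ l ih =>
    obtain ⟨hlt, -⟩ := List.getElem?_eq_some_iff.1 hv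
    obtain ⟨x, hx⟩ : ∃ x, p[k + l]? = some x := ⟨_, List.getElem?_eq_getElem (by omega)⟩
    have := ih hx
    rcases hp.step (pair_infix_iff.2 ⟨k + l, hx, hv⟩) with ⟨h1, h2⟩ | ⟨h1, h2⟩
    · rw [h1, h2]
      omega
    · rw [h1, h2]
      omega

/-- A path visits each point at most once, as the sum of the coordinates increases. -/
theorem index_unique (hp : IsNestPath p) {k l : ℕ} (hk : p[k]? = some v) (hl : p[l]? = some v) :
    k = l := by
  rcases le_total k l with h | h
  · obtain ⟨d, rfl⟩ := Nat.exists_eq_add_of_le h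
    have := hp.add_eq hk hl
    omega
  · obtain ⟨d, rfl⟩ := Nat.exists_eq_add_of_le h
    have := hp.add_eq hl hk
    omega

theorem pred_unique (hp : IsNestPath p) (hu : [u, v] <:+: p) (hw : [w, v] <:+: p) : u = w := by
  obtain ⟨k, h1, h2⟩ := pair_infix_iff.1 hu
  obtain ⟨l, h3, h4⟩ := pair_infix_iff.1 hw
  obtain rfl : k = l := by simpa using hp.index_unique h2 h4
  simpa using h1.symm.trans h3

theorem succ_unique (hp : IsNestPath p) (hu : [v, u] <:+: p) (hw : [v, w] <:+: p) : u = w := by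
  obtain ⟨k, h1, h2⟩ := pair_infix_iff.1 hu
  obtain ⟨l, h3, h4⟩ := pair_infix_iff.1 hw
  obtain rfl := hp.index_unique h1 h3
  simpa using h2.symm.trans h4

theorem head?_or_exists_pred (hv : v ∈ p) : p.head? = some v ∨ ∃ u, [u, v] <:+: p := by
  obtain ⟨k, hk⟩ := List.mem_iff_getElem?.1 hv
  cases k with
  | zero => exact Or.inl (by rw [List.head?_eq_getElem?, hk])
  | succ k =>
    obtain ⟨hlt, -⟩ := List.getElem?_eq_some_iff.1 hk
    exact Or.inr ⟨p[k], pair_infix_iff.2 ⟨k, List.getElem?_eq_getElem _, hk⟩⟩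

theorem not_pred_head? (hp : IsNestPath p) (hv : p.head? = some v) : ¬[u, v] <:+: p := by
  intro h
  obtain ⟨k, -, h2⟩ := pair_infix_iff.1 h
  rw [List.head?_eq_getElem?] at hv
  have := hp.index_unique h2 hv
  omega

theorem col_of_head? (hp : IsNestPath p) (hv : p.head? = some v) : v.2.val = 0 := by
  obtain ⟨w, hw, h⟩ := hp.start
  obtain rfl : v = w := by simpa using hv.symm.trans hw
  exact h

theorem exists_succ (hp : IsNestPath p) (hv : v ∈ p) (hm : v.1.val + 1 ≠ m) :
    ∃ w, [v, w] <:+: p := by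
  obtain ⟨k, hk⟩ := List.mem_iff_getElem?.1 hv
  obtain ⟨hlt, -⟩ := List.getElem?_eq_some_iff.1 hk
  by_cases h : k + 1 < p.length
  · exact ⟨p[k + 1], pair_infix_iff.2 ⟨k, hk, List.getElem?_eq_getElem _⟩⟩
  · obtain ⟨w, hw, hwm⟩ := hp.finish
    rw [List.getLast?_eq_getElem?, show p.length - 1 = k by omega] at hw
    obtain rfl : v = w := by simpa using hk.symm.trans hw
    exact absurd hwm hm

theorem entersNorth_iff (hp : IsNestPath p) :
    EntersNorth p v ↔ ∃ u, SouthStep u v ∧ u ∈ p ∧ ¬LeavesEast p u := by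
  constructor
  · rintro ⟨u, hu, hs⟩
    refine ⟨u, hs, (mem_of_pair_infix hu).1, ?_⟩
    rintro ⟨w, hw, he⟩
    obtain rfl := hp.succ_unique hu hw
    have := hs.1
    rw [he.1] at this
    omega
  · rintro ⟨u, hs, hu, hne⟩
    obtain ⟨w, hw⟩ := hp.exists_succ hu (by have := hs.1; omega)
    rcases hp.step hw with h | h
    · obtain rfl : v = w := Prod.ext (Fin.ext (hs.1.trans h.1.symm)) (hs.2.trans h.2.symm)
      exact ⟨u, hw, hs⟩
    · exact absurd ⟨w, hw, h⟩ hne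

theorem leavesEast_iff (hp : IsNestPath p) (hs : EastStep u v) :
    LeavesEast p u ↔ v ∈ p ∧ ¬EntersNorth p v := by
  constructor
  · rintro ⟨w, hw, he⟩
    obtain rfl : v = w := Prod.ext (hs.1.trans he.1.symm) (Fin.ext (hs.2.trans he.2.symm))
    refine ⟨(mem_of_pair_infix hw).2, ?_⟩
    rintro ⟨x, hx, hxs⟩
    obtain rfl := hp.pred_unique hx hw
    have := hxs.1
    rw [he.1] at this
    omega
  · rintro ⟨hv, hn⟩
    rcases head?_or_exists_pred hv with h | ⟨x, hx⟩
    · have h0 := hp.col_of_head? h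
      have := hs.2
      omega
    · rcases hp.step hx with h | h
      · exact absurd ⟨x, hx, h⟩ hn
      · obtain rfl : u = x := by
          refine Prod.ext (hs.1.symm.trans h.1) (Fin.ext ?_)
          have h1 := hs.2
          have h2 := h.2
          omega
        exact ⟨v, hx, h⟩

theorem head?_eq_some_iff (hp : IsNestPath p) (h0 : v.2.val = 0) :
    p.head? = some v ↔ v ∈ p ∧ ¬EntersNorth p v := by
  constructor
  · intro h
    refine ⟨List.mem_of_mem_head? h, ?_⟩
    rintro ⟨u, hu, -⟩
    exact hp.not_pred_head? h hu
  · rintro ⟨hv, hn⟩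
    rcases head?_or_exists_pred hv with h | ⟨u, hu⟩
    · exact h
    · rcases hp.step hu with h | h
      · exact absurd ⟨u, hu, h⟩ hn
      · have := h.2
        omega

theorem isCorner_iff (hp : IsNestPath p) : IsCorner p v ↔ EntersNorth p v ∧ LeavesEast p v := by
  constructor
  · rintro ⟨u, w, h, hs, he⟩
    obtain ⟨k, h1, h2, h3⟩ := triple_infix_iff.1 h
    exact ⟨⟨u, pair_infix_iff.2 ⟨k, h1, h2⟩, hs⟩, ⟨w, pair_infix_iff.2 ⟨k + 1, h2, h3⟩, he⟩⟩
  · rintro ⟨⟨u, hu, hs⟩, ⟨w, hw, he⟩⟩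
    obtain ⟨k, h1, h2⟩ := pair_infix_iff.1 hu
    obtain ⟨l, h3, h4⟩ := pair_infix_iff.1 hw
    obtain rfl := hp.index_unique h2 h3
    exact ⟨u, w, triple_infix_iff.2 ⟨k, h1, h2, h4⟩, hs, he⟩

theorem mem_of_entersNorth (h : EntersNorth p v) : v ∈ p := by
  obtain ⟨u, hu, -⟩ := h
  exact (mem_of_pair_infix hu).2

theorem mem_of_leavesEast (h : LeavesEast p v) : v ∈ p := by
  obtain ⟨u, hu, -⟩ := h
  exact (mem_of_pair_infix hu).1

/-- Two paths with the same start coincide if, whenever they enter a point in the same way, they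
leave it in the same way. -/
theorem eq_of_head?_eq (hp : IsNestPath p) (hq : IsNestPath q) (h : p.head? = q.head?)
    (hpq : ∀ v, v ∈ p → v ∈ q → (EntersNorth p v ↔ EntersNorth q v) →
      (LeavesEast p v ↔ LeavesEast q v)) : p = q := by
  have getElem?_succ : ∀ {r : List (Fin m × Fin n)}, IsNestPath r → ∀ {k : ℕ} {v},
      r[k]? = some v → ∀ w, r[k + 1]? = some w ↔
        (LeavesEast r v ∧ EastStep v w) ∨ (¬LeavesEast r v ∧ SouthStep v w) := by
    intro r hr k v hv w
    constructor
    · intro hw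
      have hvw : [v, w] <:+: r := pair_infix_iff.2 ⟨k, hv, hw⟩
      rcases hr.step hvw with hs | hs
      · have hN : EntersNorth r w := ⟨v, hvw, hs⟩
        obtain ⟨x, hx, -, hxe⟩ := hr.entersNorth_iff.1 hN
        obtain rfl : x = v := by
          refine Prod.ext (Fin.ext ?_) (hx.2.symm.trans hs.2)
          have h1 := hs.1
          have h2 := hx.1
          omega
        exact Or.inr ⟨hxe, hs⟩
      · exact Or.inl ⟨⟨w, hvw, hs⟩, hs⟩
    · rintro (⟨⟨x, hx, hxe⟩, hs⟩ | ⟨hne, hs⟩)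
      · obtain rfl : w = x := Prod.ext (hs.1.trans hxe.1.symm) (Fin.ext (hs.2.trans hxe.2.symm))
        obtain ⟨l, h1, h2⟩ := pair_infix_iff.1 hx
        rwa [hr.index_unique hv h1]
      · obtain ⟨x, hx, hxs⟩ :=
          hr.entersNorth_iff.2 ⟨v, hs, List.mem_iff_getElem?.2 ⟨k, hv⟩, hne⟩
        obtain rfl : v = x := by
          refine Prod.ext (Fin.ext ?_) (hs.2.symm.trans hxs.2)
          have h1 := hs.1
          have h2 := hxs.1
          omega
        obtain ⟨l, h1, h2⟩ := pair_infix_iff.1 hx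
        rwa [hr.index_unique hv h1]
  have entersNorth_getElem? : ∀ {r : List (Fin m × Fin n)}, IsNestPath r → ∀ {k : ℕ} {v},
      r[k]? = some v → (EntersNorth r v ↔ ∃ l < k, l + 1 = k ∧ ∃ u, r[l]? = some u ∧
        SouthStep u v) := by
    intro r hr k v hv
    constructor
    · rintro ⟨u, hu, hs⟩
      obtain ⟨l, h1, h2⟩ := pair_infix_iff.1 hu
      have := hr.index_unique h2 hv
      exact ⟨l, by omega, this, u, h1, hs⟩
    · rintro ⟨l, -, rfl, u, hu, hs⟩
      exact ⟨u, pair_infix_iff.2 ⟨l, hu, hv⟩, hs⟩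
  refine List.ext_getElem? fun k => ?_
  induction k using Nat.strong_induction_on with
  | _ k ih =>
    cases k with
    | zero => rwa [List.head?_eq_getElem?, List.head?_eq_getElem?] at h
    | succ k =>
      rcases hk : p[k]? with _ | v
      · have hk' := (ih k (by omega)).symm.trans hk
        rw [List.getElem?_eq_none_iff] at hk hk'
        rw [List.getElem?_eq_none (by omega), List.getElem?_eq_none (by omega)]
      · have hk' := (ih k (by omega)).symm.trans hk
        have hN : EntersNorth p v ↔ EntersNorth q v := by
          rw [entersNorth_getElem? hp hk, entersNorth_getElem? hq hk']
          refine exists_congr fun l => and_congr_right fun hl => ?_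
          rw [ih l (by omega)]
        have hE := hpq v (List.mem_iff_getElem?.2 ⟨k, hk⟩) (List.mem_iff_getElem?.2 ⟨k, hk'⟩) hN
        ext w
        rw [getElem?_succ hp hk, getElem?_succ hq hk', hE]

end IsNestPath

/-- A path can be built step by step from a rule that tells at which points to go east, depending on
whether the point was entered from the north. The condition `b` says whether the first point counts
as entered from the north. -/
theorem exists_isChain_of_rule (e c : Fin m × Fin n → Prop) (he : ∀ v, e v → v.2.val + 1 < n)
    (v : Fin m × Fin n) (b : Prop) :
    ∃ l : List (Fin m × Fin n), (v :: l).IsChain (fun u v => SouthStep u v ∨ EastStep u v) ∧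
      (∃ w ∈ (v :: l).getLast?, w.1.val + 1 = m) ∧
      ∀ k u, (v :: l)[k]? = some u →
        ((∃ w, (v :: l)[k + 1]? = some w ∧ EastStep u w) ↔
          e u ∧ ((k = 0 ∧ b ∨ ∃ k', k' + 1 = k ∧ ∃ x, (v :: l)[k']? = some x ∧ SouthStep x u) ∨
            c u)) := by
  obtain ⟨d, hd⟩ : ∃ d, d = (m - v.1.val) + (n - v.2.val) := ⟨_, rfl⟩
  induction d using Nat.strong_induction_on generalizing v b with
  | _ d ih =>
    have hnext : (∃ w, (SouthStep v w ∨ EastStep v w) ∧ (EastStep v w ↔ e v ∧ (b ∨ c v))) ∨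
        v.1.val + 1 = m ∧ ¬(e v ∧ (b ∨ c v)) := by
      by_cases hE : e v ∧ (b ∨ c v)
      · exact Or.inl ⟨(v.1, ⟨v.2.val + 1, he v hE.1⟩), Or.inr ⟨rfl, rfl⟩,
          iff_of_true ⟨rfl, rfl⟩ hE⟩
      · by_cases hm : v.1.val + 1 = m
        · exact Or.inr ⟨hm, hE⟩
        · refine Or.inl ⟨(⟨v.1.val + 1, by omega⟩, v.2), Or.inl ⟨rfl, rfl⟩, iff_of_false ?_ hE⟩
          rintro ⟨h, -⟩
          simp [Fin.ext_iff] at h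
    rcases hnext with ⟨w, hvw, hrule⟩ | ⟨hm, hE⟩
    · obtain ⟨l, hl1, hl2, hl3⟩ := ih ((m - w.1.val) + (n - w.2.val))
        (by rcases hvw with h | h <;> have h1 := h.1 <;> have h2 := h.2
            · rw [h2]; omega
            · rw [h1]; omega) w (SouthStep v w) rfl
      refine ⟨w :: l, List.isChain_cons_cons.2 ⟨hvw, hl1⟩, ?_, fun k u hk => ?_⟩
      · rwa [List.getLast?_cons_cons]
      · cases k with
        | zero =>
          obtain rfl : v = u := by simpa using hk
          simpa using hrule
        | succ k =>
          rw [List.getElem?_cons_succ] at hk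
          rw [List.getElem?_cons_succ, hl3 k u hk]
          refine and_congr_right fun _ => or_congr_left ?_
          cases k with
          | zero =>
            obtain rfl : w = u := by simpa using hk
            simp [-Prod.exists]
          | succ k => simp
    · refine ⟨[], List.isChain_singleton v, ⟨v, by simp, hm⟩, fun k u hk => ?_⟩
      cases k with
      | zero =>
        obtain rfl : v = u := by simpa using hk
        simpa using hE
      | succ k => simp at hk

theorem exists_isNestPath_of_rule (e c : Fin m × Fin n → Prop) (he : ∀ v, e v → v.2.val + 1 < n)
    {v : Fin m × Fin n} (hv : v.2.val = 0) :
    ∃ p, IsNestPath p ∧ p.head? = some v ∧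
      ∀ u ∈ p, (LeavesEast p u ↔ e u ∧ (EntersNorth p u ∨ c u)) := by
  obtain ⟨l, hl1, hl2, hl3⟩ := exists_isChain_of_rule e c he v False
  have hp : IsNestPath (v :: l) := ⟨hl1, ⟨v, by simp, hv⟩, hl2⟩
  refine ⟨v :: l, hp, rfl, fun u hu => ?_⟩
  obtain ⟨k, hk⟩ := List.mem_iff_getElem?.1 hu
  have hE : LeavesEast (v :: l) u ↔ ∃ w, (v :: l)[k + 1]? = some w ∧ EastStep u w := by
    refine exists_congr fun w => and_congr_left fun _ => ?_
    rw [pair_infix_iff]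
    refine ⟨?_, fun h => ⟨k, hk, h⟩⟩
    rintro ⟨k', h1, h2⟩
    rwa [hp.index_unique hk h1]
  have hN : EntersNorth (v :: l) u ↔
      ∃ k', k' + 1 = k ∧ ∃ x, (v :: l)[k']? = some x ∧ SouthStep x u := by
    constructor
    · rintro ⟨x, hx, hs⟩
      obtain ⟨k', h1, h2⟩ := pair_infix_iff.1 hx
      exact ⟨k', hp.index_unique h2 hk, x, h1, hs⟩
    · rintro ⟨k', rfl, x, hx, hs⟩
      exact ⟨x, pair_infix_iff.2 ⟨k', hx, hk⟩, hs⟩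
  rw [hE, hl3 k u hk, hN]
  simp

/-! ### The nest of a matrix -/

theorem mem_pasmToNest {M : Matrix (Fin m) (Fin n) ℤ} {p : List (Fin m × Fin n)} :
    p ∈ pasmToNest M ↔ IsNestPath p ∧ (∀ v ∈ p.head?, UsesWestEdge M v.1 0) ∧
      ∀ v ∈ p, (LeavesEast p v ↔ UsesWestEdge M v.1 (v.2.val + 1) ∧
        (EntersNorth p v ∨ ¬UsesNorthEdge M v.1.val v.2)) :=
  Iff.rfl

/-- At each point, the number of used edges to the west and north equals the number of used edges to
the east and south. -/
theorem IsPASM.conserve {M : Matrix (Fin m) (Fin n) ℤ} (hM : IsPASM M) (v : Fin m × Fin n) :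
    (UsesWestEdge M v.1 v.2 ∧ UsesNorthEdge M v.1 v.2 ↔
      UsesWestEdge M v.1 (v.2 + 1) ∧ UsesNorthEdge M (v.1 + 1) v.2) ∧
    (UsesWestEdge M v.1 v.2 ∨ UsesNorthEdge M v.1 v.2 ↔
      UsesWestEdge M v.1 (v.2 + 1) ∨ UsesNorthEdge M (v.1 + 1) v.2) := by
  obtain ⟨hr, hc⟩ := (isPASM_iff M).1 hM
  have e1 := suffixSum_eq_add (M v.1) v.2
  have e2 := prefixSum_succ (fun i => M i v.2) v.1
  have := hr v.1 v.2
  have := hr v.1 (v.2 + 1)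
  have := hc v.2 v.1
  have := hc v.2 (v.1 + 1)
  change ((suffixSum (M v.1) v.2 = 1 ∧ prefixSum (fun i => M i v.2) v.1 = 1) ↔
    (suffixSum (M v.1) (v.2 + 1) = 1 ∧ prefixSum (fun i => M i v.2) (v.1 + 1) = 1)) ∧
    ((suffixSum (M v.1) v.2 = 1 ∨ prefixSum (fun i => M i v.2) v.1 = 1) ↔
    (suffixSum (M v.1) (v.2 + 1) = 1 ∨ prefixSum (fun i => M i v.2) (v.1 + 1) = 1))
  omega

theorem not_usesNorthEdge_zero (M : Matrix (Fin m) (Fin n) ℤ) (j : Fin n) :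
    ¬UsesNorthEdge M 0 j := by
  change ¬prefixSum (fun i => M i j) 0 = 1
  rw [prefixSum_zero]
  decide

theorem UsesWestEdge.lt {M : Matrix (Fin m) (Fin n) ℤ} {i : Fin m} {j : ℕ}
    (h : UsesWestEdge M i j) : j < n := by
  by_contra hj
  have : suffixSum (M i) j = 1 := h
  rw [suffixSum_of_le _ (by omega)] at this
  exact absurd this (by decide)

theorem EastStep.usesWestEdge_iff {u v : Fin m × Fin n} (h : EastStep u v)
    (M : Matrix (Fin m) (Fin n) ℤ) :
    UsesWestEdge M u.1 (u.2 + 1) ↔ UsesWestEdge M v.1 v.2 := by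
  rw [h.1, h.2]

theorem SouthStep.usesNorthEdge_iff {u v : Fin m × Fin n} (h : SouthStep u v)
    (M : Matrix (Fin m) (Fin n) ℤ) :
    UsesNorthEdge M (u.1 + 1) u.2 ↔ UsesNorthEdge M v.1 v.2 := by
  rw [h.1, h.2]

theorem exists_southStep {v : Fin m × Fin n} (h : v.1.val ≠ 0) : ∃ u, SouthStep u v :=
  ⟨(⟨v.1.val - 1, by omega⟩, v.2), by simp only; omega, rfl⟩

theorem exists_eastStep {v : Fin m × Fin n} (h : v.2.val ≠ 0) : ∃ u, EastStep u v :=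
  ⟨(v.1, ⟨v.2.val - 1, by omega⟩), rfl, by simp only; omega⟩

theorem SouthStep.left_unique {u u' v : Fin m × Fin n} (h : SouthStep u v) (h' : SouthStep u' v) :
    u = u' := by
  refine Prod.ext (Fin.ext ?_) (h.2.symm.trans h'.2)
  have h1 := h.1
  have h2 := h'.1
  omega

theorem SouthStep.add_lt {u v : Fin m × Fin n} (h : SouthStep u v) :
    u.1.val + u.2.val < v.1.val + v.2.val := by
  rw [h.1, h.2]
  omega

theorem EastStep.add_lt {u v : Fin m × Fin n} (h : EastStep u v) :
    u.1.val + u.2.val < v.1.val + v.2.val := by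
  rw [h.1, h.2]
  omega

/-- Induction along the steps of the grid. -/
theorem grid_induction {P : Fin m × Fin n → Prop}
    (h : ∀ v, (∀ u, SouthStep u v ∨ EastStep u v → P u) → P v) (v : Fin m × Fin n) : P v := by
  obtain ⟨d, hd⟩ : ∃ d, d = v.1.val + v.2.val := ⟨_, rfl⟩
  induction d using Nat.strong_induction_on generalizing v with
  | _ d ih =>
    exact h v fun u hu => ih _ (by rw [hd]; rcases hu with hu | hu <;> exact hu.add_lt) u rfl

variable {M : Matrix (Fin m) (Fin n) ℤ} {p q : List (Fin m × Fin n)}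

/-- The paths of the nest of `M` use only those edges that `M` prescribes. -/
theorem usesEdge_of_mem_pasmToNest (hM : IsPASM M) (hp : p ∈ pasmToNest M) (v : Fin m × Fin n)
    (hv : v ∈ p) :
    (EntersNorth p v → UsesNorthEdge M v.1 v.2) ∧ (¬EntersNorth p v → UsesWestEdge M v.1 v.2) := by
  obtain ⟨hpath, hhead, hrule⟩ := mem_pasmToNest.1 hp
  induction v using grid_induction with
  | h v ih =>
  constructor
  · intro hN
    obtain ⟨u, hs, hu, hE⟩ := hpath.entersNorth_iff.1 hN
    have := ih u (Or.inl hs) hu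
    have := hM.conserve u
    rw [hrule u hu] at hE
    rw [← hs.usesNorthEdge_iff]
    tauto
  · intro hN
    by_cases h0 : v.2.val = 0
    · rw [h0]
      exact hhead v ((hpath.head?_eq_some_iff h0).2 ⟨hv, hN⟩)
    · obtain ⟨u, hs⟩ := exists_eastStep h0
      have hE := (hpath.leavesEast_iff hs).2 ⟨hv, hN⟩
      rw [← hs.usesWestEdge_iff]
      exact ((hrule u (IsNestPath.mem_of_leavesEast hE)).1 hE).1

/-- Two paths of the nest that enter a point in the same way coincide, as they can be traced back to
the same start. -/
theorem eq_of_mem_pasmToNest (hM : IsPASM M) (hp : p ∈ pasmToNest M) (hq : q ∈ pasmToNest M)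
    {v : Fin m × Fin n} (hvp : v ∈ p) (hvq : v ∈ q) (hN : EntersNorth p v ↔ EntersNorth q v) :
    p = q := by
  have hp' := mem_pasmToNest.1 hp
  have hq' := mem_pasmToNest.1 hq
  refine hp'.1.eq_of_head?_eq hq'.1 ?_ fun v h1 h2 h3 => by rw [hp'.2.2 v h1, hq'.2.2 v h2, h3]
  induction v using grid_induction with
  | h v ih =>
  have key : ∀ u, SouthStep u v ∨ EastStep u v → u ∈ p → u ∈ q →
      (LeavesEast p u ↔ LeavesEast q u) → p.head? = q.head? := by
    intro u hu h1 h2 hE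
    have hup := usesEdge_of_mem_pasmToNest hM hp u h1
    have huq := usesEdge_of_mem_pasmToNest hM hq u h2
    have := hM.conserve u
    refine ih u hu h1 h2 ?_
    rw [hp'.2.2 u h1, hq'.2.2 u h2] at hE
    grind only
  by_cases hNp : EntersNorth p v
  · obtain ⟨u, hs, h1, h2⟩ := hp'.1.entersNorth_iff.1 hNp
    obtain ⟨u', hs', h3, h4⟩ := hq'.1.entersNorth_iff.1 (hN.1 hNp)
    obtain rfl := hs.left_unique hs'
    exact key u (Or.inl hs) h1 h3 (iff_of_false h2 h4)
  · have hNq : ¬EntersNorth q v := fun h => hNp (hN.2 h)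
    by_cases h0 : v.2.val = 0
    · rw [(hp'.1.head?_eq_some_iff h0).2 ⟨hvp, hNp⟩, (hq'.1.head?_eq_some_iff h0).2 ⟨hvq, hNq⟩]
    · obtain ⟨u, hs⟩ := exists_eastStep h0
      have h1 := (hp'.1.leavesEast_iff hs).2 ⟨hvp, hNp⟩
      have h2 := (hq'.1.leavesEast_iff hs).2 ⟨hvq, hNq⟩
      exact key u (Or.inr hs) (IsNestPath.mem_of_leavesEast h1) (IsNestPath.mem_of_leavesEast h2)
        (iff_of_true h1 h2)

theorem isNest_pasmToNest (hM : IsPASM M) : IsNest (pasmToNest M) where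
  path p hp := hp.1
  osculate p hp q hq hpq := by
    have hp' := mem_pasmToNest.1 hp
    have hq' := mem_pasmToNest.1 hq
    have key : ∀ v, v ∈ p → v ∈ q → ¬(EntersNorth p v ↔ EntersNorth q v) :=
      fun v h1 h2 h => hpq (eq_of_mem_pasmToNest hM hp hq h1 h2 h)
    refine ⟨fun u v ⟨hup, huq⟩ => ?_, fun v hvp hvq => ?_⟩
    · refine key v (mem_of_pair_infix hup).2 (mem_of_pair_infix huq).2 ?_
      constructor
      · rintro ⟨w, hw, hs⟩
        obtain rfl := hp'.1.pred_unique hw hup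
        exact ⟨w, huq, hs⟩
      · rintro ⟨w, hw, hs⟩
        obtain rfl := hq'.1.pred_unique hw huq
        exact ⟨w, hup, hs⟩
    · have h1 := usesEdge_of_mem_pasmToNest hM hp v hvp
      have h2 := usesEdge_of_mem_pasmToNest hM hq v hvq
      have h3 := key v hvp hvq
      have h4 := hM.conserve v
      rw [hp'.1.isCorner_iff, hq'.1.isCorner_iff, hp'.2.2 v hvp, hq'.2.2 v hvq]
      grind only

/-- Every edge that `M` prescribes lies on a path of the nest. -/
theorem exists_mem_pasmToNest (hM : IsPASM M) (v : Fin m × Fin n) :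
    (UsesWestEdge M v.1 v.2 → ∃ p ∈ pasmToNest M, v ∈ p ∧ ¬EntersNorth p v) ∧
      (UsesNorthEdge M v.1 v.2 → ∃ p ∈ pasmToNest M, EntersNorth p v) := by
  induction v using grid_induction with
  | h v ih =>
  constructor
  · intro hw
    by_cases h0 : v.2.val = 0
    · obtain ⟨p, hp, hhead, hrule⟩ := exists_isNestPath_of_rule
        (fun v => UsesWestEdge M v.1 (v.2 + 1)) (fun v => ¬UsesNorthEdge M v.1 v.2)
        (fun v hv => hv.lt) h0
      refine ⟨p, mem_pasmToNest.2 ⟨hp, fun w hw' => ?_, hrule⟩,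
        (hp.head?_eq_some_iff h0).1 hhead⟩
      obtain rfl : v = w := by simpa using hhead.symm.trans hw'
      rwa [h0] at hw
    · obtain ⟨u, hs⟩ := exists_eastStep h0
      rw [← hs.usesWestEdge_iff] at hw
      have hu := ih u (Or.inr hs)
      have hc := hM.conserve u
      suffices ∃ p ∈ pasmToNest M, LeavesEast p u by
        obtain ⟨p, hp, hE⟩ := this
        exact ⟨p, hp, (hp.1.leavesEast_iff hs).1 hE⟩
      by_cases hn : UsesNorthEdge M u.1 u.2
      · obtain ⟨p, hp, hN⟩ := hu.2 hn
        exact ⟨p, hp, ((mem_pasmToNest.1 hp).2.2 u (IsNestPath.mem_of_entersNorth hN)).2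
          ⟨hw, Or.inl hN⟩⟩
      · obtain ⟨p, hp, hup, -⟩ := hu.1 (by tauto)
        exact ⟨p, hp, ((mem_pasmToNest.1 hp).2.2 u hup).2 ⟨hw, Or.inr hn⟩⟩
  · intro hn
    have h0 : v.1.val ≠ 0 := by
      intro h0
      rw [h0] at hn
      exact not_usesNorthEdge_zero M v.2 hn
    obtain ⟨u, hs⟩ := exists_southStep h0
    rw [← hs.usesNorthEdge_iff] at hn
    have hu := ih u (Or.inl hs)
    have hc := hM.conserve u
    suffices ∃ p ∈ pasmToNest M, u ∈ p ∧ ¬LeavesEast p u by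
      obtain ⟨p, hp, hup, hE⟩ := this
      exact ⟨p, hp, hp.1.entersNorth_iff.2 ⟨u, hs, hup, hE⟩⟩
    by_cases hw : UsesWestEdge M u.1 u.2
    · obtain ⟨p, hp, hup, hN⟩ := hu.1 hw
      refine ⟨p, hp, hup, fun hE => ?_⟩
      have := ((mem_pasmToNest.1 hp).2.2 u hup).1 hE
      tauto
    · obtain ⟨p, hp, hN⟩ := hu.2 (by tauto)
      have hup := IsNestPath.mem_of_entersNorth hN
      refine ⟨p, hp, hup, fun hE => ?_⟩
      have := ((mem_pasmToNest.1 hp).2.2 u hup).1 hE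
      tauto

theorem usesWestEdge_iff_exists_mem_pasmToNest (hM : IsPASM M) (v : Fin m × Fin n) :
    UsesWestEdge M v.1 v.2 ↔ ∃ p ∈ pasmToNest M, v ∈ p ∧ ¬EntersNorth p v :=
  ⟨(exists_mem_pasmToNest hM v).1,
    fun ⟨_, hp, hv, hN⟩ => (usesEdge_of_mem_pasmToNest hM hp v hv).2 hN⟩

theorem injOn_pasmToNest : Set.InjOn pasmToNest (PASM m n) := by
  intro M hM M' hM' h
  refine eq_of_suffixSum_eq fun i j => ?_
  have h1 := usesWestEdge_iff_exists_mem_pasmToNest hM (i, j)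
  rw [h, ← usesWestEdge_iff_exists_mem_pasmToNest hM' (i, j)] at h1
  change suffixSum (M i) j = 1 ↔ suffixSum (M' i) j = 1 at h1
  have h2 := ((isPASM_iff M).1 hM).1 i j
  have h3 := ((isPASM_iff M').1 hM').1 i j
  omega

/-! ### The matrix of a nest -/

/-- At a common point of two paths of a nest, one path enters from the north and leaves to the east,
and the other path does neither. -/
theorem IsNest.touch {N : Set (List (Fin m × Fin n))} (hN : IsNest N) (hp : p ∈ N) (hq : q ∈ N)
    (hpq : p ≠ q) {v : Fin m × Fin n} (hvp : v ∈ p) (hvq : v ∈ q) :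
    EntersNorth p v ∧ LeavesEast p v ∧ ¬EntersNorth q v ∧ ¬LeavesEast q v ∨
      EntersNorth q v ∧ LeavesEast q v ∧ ¬EntersNorth p v ∧ ¬LeavesEast p v := by
  obtain ⟨hstep, hcorner⟩ := hN.osculate p hp q hq hpq
  have h1 : ¬(EntersNorth p v ∧ EntersNorth q v) := by
    rintro ⟨⟨u, hu, hs⟩, ⟨u', hu', hs'⟩⟩
    obtain rfl := hs.left_unique hs'
    exact hstep u v ⟨hu, hu'⟩
  have h2 : ¬(LeavesEast p v ∧ LeavesEast q v) := by
    rintro ⟨⟨w, hw, hs⟩, ⟨w', hw', hs'⟩⟩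
    obtain rfl : w = w' := Prod.ext (hs.1.trans hs'.1.symm) (Fin.ext (hs.2.trans hs'.2.symm))
    exact hstep v w ⟨hw, hw'⟩
  have h3 := hcorner v hvp hvq
  rw [(hN.path p hp).isCorner_iff, (hN.path q hq).isCorner_iff] at h3
  tauto

theorem IsNest.conserve {N : Set (List (Fin m × Fin n))} (hN : IsNest N) (v : Fin m × Fin n) :
    ((∃ p ∈ N, v ∈ p ∧ ¬EntersNorth p v) ∧ (∃ p ∈ N, EntersNorth p v) ↔
      (∃ p ∈ N, LeavesEast p v) ∧ (∃ p ∈ N, v ∈ p ∧ ¬LeavesEast p v)) ∧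
    ((∃ p ∈ N, v ∈ p ∧ ¬EntersNorth p v) ∨ (∃ p ∈ N, EntersNorth p v) ↔
      (∃ p ∈ N, LeavesEast p v) ∨ (∃ p ∈ N, v ∈ p ∧ ¬LeavesEast p v)) := by
  have hmem : ∀ p, EntersNorth p v → v ∈ p := fun p => IsNestPath.mem_of_entersNorth
  have hmem' : ∀ p, LeavesEast p v → v ∈ p := fun p => IsNestPath.mem_of_leavesEast
  refine ⟨⟨?_, ?_⟩, ⟨?_, ?_⟩⟩
  · rintro ⟨⟨p, hp, hvp, hnp⟩, q, hq, hnq⟩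
    have hne : p ≠ q := fun h => hnp (h ▸ hnq)
    have := hN.touch hp hq hne hvp (hmem q hnq)
    exact ⟨⟨q, hq, by tauto⟩, p, hp, hvp, by tauto⟩
  · rintro ⟨⟨p, hp, hnp⟩, q, hq, hvq, hnq⟩
    have hne : p ≠ q := fun h => hnq (h ▸ hnp)
    have := hN.touch hp hq hne (hmem' p hnp) hvq
    exact ⟨⟨q, hq, hvq, by tauto⟩, p, hp, by tauto⟩
  · intro h
    obtain ⟨p, hp, hv⟩ : ∃ p ∈ N, v ∈ p := by
      rcases h with ⟨p, hp, h, -⟩ | ⟨p, hp, h⟩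
      · exact ⟨p, hp, h⟩
      · exact ⟨p, hp, hmem p h⟩
    by_cases hE : LeavesEast p v
    · exact Or.inl ⟨p, hp, hE⟩
    · exact Or.inr ⟨p, hp, hv, hE⟩
  · intro h
    obtain ⟨p, hp, hv⟩ : ∃ p ∈ N, v ∈ p := by
      rcases h with ⟨p, hp, h⟩ | ⟨p, hp, h, -⟩
      · exact ⟨p, hp, hmem' p h⟩
      · exact ⟨p, hp, h⟩
    by_cases hE : EntersNorth p v
    · exact Or.inr ⟨p, hp, hE⟩
    · exact Or.inl ⟨p, hp, hv, hE⟩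

/-- A nest determines a flow on the edges of the grid, and thereby a matrix. -/
theorem IsNest.exists_mem_PASM {N : Set (List (Fin m × Fin n))} (hN : IsNest N) :
    ∃ M ∈ PASM m n, ∀ v : Fin m × Fin n,
      (UsesWestEdge M v.1 v.2 ↔ ∃ p ∈ N, v ∈ p ∧ ¬EntersNorth p v) ∧
      (UsesNorthEdge M v.1 v.2 ↔ ∃ p ∈ N, EntersNorth p v) ∧
      (UsesWestEdge M v.1 (v.2 + 1) ↔ ∃ p ∈ N, LeavesEast p v) := by
  classical
  -- The edges into the grid and out of it at the bottom are those where paths start and end.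
  let R : Fin m → ℕ → Prop := fun i j => ∃ hj : j < n, ∃ p ∈ N, (i, ⟨j, hj⟩) ∈ p ∧
    ¬EntersNorth p (i, ⟨j, hj⟩)
  let C : ℕ → Fin n → Prop := fun i j => ∃ i' : Fin m, i'.val + 1 = i ∧ ∃ p ∈ N, (i', j) ∈ p ∧
    ¬LeavesEast p (i', j)
  have hRC : ∀ v : Fin m × Fin n, (R v.1 v.2 ↔ ∃ p ∈ N, v ∈ p ∧ ¬EntersNorth p v) ∧
      (C v.1 v.2 ↔ ∃ p ∈ N, EntersNorth p v) ∧
      (R v.1 (v.2 + 1) ↔ ∃ p ∈ N, LeavesEast p v) ∧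
      (C (v.1 + 1) v.2 ↔ ∃ p ∈ N, v ∈ p ∧ ¬LeavesEast p v) := by
    intro v
    refine ⟨⟨fun ⟨_, h⟩ => h, fun h => ⟨v.2.isLt, h⟩⟩, ⟨?_, ?_⟩, ⟨?_, ?_⟩, ⟨?_, ?_⟩⟩
    · rintro ⟨i, hi, p, hp, h⟩
      exact ⟨p, hp, (hN.path p hp).entersNorth_iff.2 ⟨(i, v.2), ⟨hi.symm, rfl⟩, h⟩⟩
    · rintro ⟨p, hp, h⟩
      obtain ⟨u, hs, h1, h2⟩ := (hN.path p hp).entersNorth_iff.1 h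
      rw [hs.1, hs.2]
      exact ⟨u.1, rfl, p, hp, h1, h2⟩
    · rintro ⟨hj, p, hp, h⟩
      exact ⟨p, hp, ((hN.path p hp).leavesEast_iff (u := v) (v := (v.1, ⟨v.2 + 1, hj⟩))
        ⟨rfl, rfl⟩).2 h⟩
    · rintro ⟨p, hp, h⟩
      obtain ⟨w, hw, hs⟩ := id h
      have hj : v.2.val + 1 < n := hs.2 ▸ w.2.isLt
      exact ⟨hj, p, hp, ((hN.path p hp).leavesEast_iff (u := v) (v := (v.1, ⟨v.2 + 1, hj⟩))
        ⟨rfl, rfl⟩).1 h⟩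
    · rintro ⟨i, hi, h⟩
      obtain rfl : i = v.1 := Fin.ext (by omega)
      exact h
    · exact fun h => ⟨v.1, rfl, h⟩
  obtain ⟨M, hM, h1, h2⟩ := exists_mem_PASM_of_flow
    (fun i j => if R i j then 1 else 0) (fun i j => if C i j then 1 else 0)
    (fun i => if_neg fun ⟨hj, _⟩ => lt_irrefl _ hj) (fun j => if_neg fun ⟨i, hi, _⟩ => by omega)
    (fun i j => by
      have hc := hN.conserve (i, j)
      obtain ⟨e1, e2, e3, e4⟩ := hRC (i, j)
      rw [← e1, ← e2, ← e3, ← e4] at hc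
      simp only at hc
      split_ifs <;> first | rfl | grind only)
    (fun i j _ => by split_ifs <;> simp) (fun i j _ => by split_ifs <;> simp)
  have hR : ∀ i, ∀ j ≤ n, (UsesWestEdge M i j ↔ R i j) := by
    intro i j hj
    change suffixSum (M i) j = 1 ↔ _
    rw [h1 i j hj]
    split_ifs with h <;> simp [h]
  have hC : ∀ i ≤ m, ∀ j, (UsesNorthEdge M i j ↔ C i j) := by
    intro i hi j
    change prefixSum (fun i' => M i' j) i = 1 ↔ _
    rw [h2 j i hi]
    split_ifs with h <;> simp [h]
  refine ⟨M, hM, fun v => ?_⟩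
  rw [hR _ _ v.2.isLt.le, hC _ v.1.isLt.le, hR _ _ v.2.isLt]
  exact ⟨(hRC v).1, (hRC v).2.1, (hRC v).2.2.1⟩

theorem bijOn_pasmToNest : Set.BijOn pasmToNest (PASM m n) (Nests m n) := by
  refine ⟨fun M hM => isNest_pasmToNest hM, injOn_pasmToNest, fun N hN => ?_⟩
  obtain ⟨M, hM, huse⟩ := IsNest.exists_mem_PASM hN
  have hsub : N ⊆ pasmToNest M := by
    intro p hp
    have hpath := hN.path p hp
    refine mem_pasmToNest.2 ⟨hpath, fun v hv => ?_, fun v hv => ?_⟩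
    · have h0 := hpath.col_of_head? hv
      have := (huse v).1.2 ⟨p, hp, (hpath.head?_eq_some_iff h0).1 hv⟩
      rwa [h0] at this
    · rw [(huse v).2.2, (huse v).2.1]
      constructor
      · intro hE
        refine ⟨⟨p, hp, hE⟩, or_iff_not_imp_left.2 ?_⟩
        rintro hNp ⟨q, hq, hNq⟩
        have hne : p ≠ q := fun h => hNp (h ▸ hNq)
        have := hN.touch hp hq hne hv (IsNestPath.mem_of_entersNorth hNq)
        tauto
      · rintro ⟨⟨q, hq, hEq⟩, h⟩
        by_contra hE
        have hne : p ≠ q := fun h => hE (h ▸ hEq)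
        have := hN.touch hp hq hne hv (IsNestPath.mem_of_leavesEast hEq)
        rcases h with h | h
        · tauto
        · exact h ⟨q, hq, by tauto⟩
  refine ⟨M, hM, Set.Subset.antisymm (fun p hp => ?_) hsub⟩
  -- A path of the nest of `M` starts where a path `q` of `N` starts, and it coincides with `q`.
  obtain ⟨v, hv, h0⟩ := hp.1.start
  have hw := hp.2.1 v hv
  rw [← h0, (huse v).1] at hw
  obtain ⟨q, hq, hvq, hNq⟩ := hw
  obtain ⟨hvp, hNp⟩ := (hp.1.head?_eq_some_iff h0).1 hv
  rwa [eq_of_mem_pasmToNest hM hp (hsub hq) hvp hvq (iff_of_false hNp hNq)]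

/-! ### From matrices to triangles -/

/-- The number of entries of `f` that are at least `c`. -/
def tailCount {k : ℕ} (f : Fin k → ℕ) (c : ℕ) : ℕ := (Finset.univ.filter fun j => c ≤ f j).card

theorem tailCount_le {k : ℕ} (f : Fin k → ℕ) (c : ℕ) : tailCount f c ≤ k :=
  (Finset.card_le_univ _).trans (Fintype.card_fin k).le

theorem tailCount_antitone {k : ℕ} (f : Fin k → ℕ) : Antitone (tailCount f) := by
  intro c d hcd
  refine Finset.card_le_card fun j hj => ?_
  simp only [Finset.mem_filter, Finset.mem_univ, true_and] at hj ⊢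
  omega

/-- The large entries of an increasing sequence are at its end. -/
theorem le_apply_iff_le_add_tailCount {k : ℕ} {f : Fin k → ℕ} (hf : Monotone f) (c : ℕ)
    (j : Fin k) : c ≤ f j ↔ k ≤ j + tailCount f c := by
  constructor
  · intro h
    have : (Finset.Ici j).card ≤ tailCount f c := Finset.card_le_card fun l hl => by
      simp only [Finset.mem_filter, Finset.mem_univ, true_and]
      exact h.trans (hf (Finset.mem_Ici.1 hl))
    rw [Fin.card_Ici] at this
    omega
  · intro h
    by_contra hlt
    have : tailCount f c ≤ (Finset.Ioi j).card := Finset.card_le_card fun l hl => by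
      simp only [Finset.mem_filter, Finset.mem_univ, true_and] at hl
      refine Finset.mem_Ioi.2 (lt_of_not_ge fun hlj => hlt (hl.trans (hf hlj)))
    rw [Fin.card_Ioi] at this
    omega

theorem eq_of_tailCount_eq {k : ℕ} {f g : Fin k → ℕ} (hf : Monotone f) (hg : Monotone g)
    (h : ∀ c, tailCount f (c + 1) = tailCount g (c + 1)) : f = g := by
  have key : ∀ j c, c ≤ f j ↔ c ≤ g j := by
    intro j c
    cases c with
    | zero => simp
    | succ c => rw [le_apply_iff_le_add_tailCount hf, le_apply_iff_le_add_tailCount hg, h]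
  funext j
  exact le_antisymm ((key j _).1 le_rfl) ((key j _).2 le_rfl)

theorem tailCount_getD (L : List ℕ) {k : ℕ} (hk : L.length = k) (c : ℕ) :
    tailCount (fun j : Fin k => L.getD j 0) c = L.countP (c ≤ ·) := by
  induction L generalizing k with
  | nil =>
    subst hk
    rfl
  | cons x L ih =>
    subst hk
    refine (Fin.card_filter_univ_succ fun j : Fin (L.length + 1) =>
      c ≤ (x :: L).getD j.val 0).trans ?_
    rw [List.countP_cons, ← ih rfl]
    simp only [tailCount, Fin.val_zero, List.getD_cons_zero, Fin.val_succ, List.getD_cons_succ,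
      decide_eq_true_eq]
    split_ifs <;> omega

theorem colPartialSum_eq (M : Matrix (Fin m) (Fin n) ℤ) (i : Fin m) (j : Fin n) :
    colPartialSum M i j = prefixSum (fun i' => M i' j) (i + 1) := by
  refine Finset.sum_congr (Finset.filter_congr fun i' _ => ?_) fun _ _ => rfl
  rw [Fin.le_def]
  omega

/-- The corner sums count active columns. -/
theorem card_filter_activeColumns {M : Matrix (Fin m) (Fin n) ℤ} (hM : IsPASM M) (i : Fin m)
    (c : ℕ) :
    (((activeColumns M i).filter (c + 1 ≤ ·)).card : ℤ) = cornerSum M (i + 1) c := by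
  have hcomm : cornerSum M (i + 1) c =
      ∑ j : Fin n with c ≤ j.val, prefixSum (fun i' => M i' j) (i + 1) := Finset.sum_comm
  have hfilter : (Finset.univ.filter fun j : Fin n => colPartialSum M i j = 1 ∧ c + 1 ≤ j.val + 1) =
      (Finset.univ.filter fun j : Fin n => c ≤ j.val).filter fun j => colPartialSum M i j = 1 := by
    ext j
    simp only [Finset.mem_filter, Finset.mem_univ, true_and]
    omega
  rw [hcomm, activeColumns, Finset.filter_image, Finset.card_image_of_injective _
    fun a b h => Fin.ext (by simpa using h), Finset.filter_filter, hfilter, Finset.card_filter]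
  push_cast
  refine Finset.sum_congr rfl fun j _ => ?_
  have := ((isPASM_iff M).1 hM).2 j (i + 1)
  rw [colPartialSum_eq]
  split_ifs <;> omega

theorem mem_activeColumns {M : Matrix (Fin m) (Fin n) ℤ} {i : Fin m} {x : ℕ}
    (hx : x ∈ activeColumns M i) : 1 ≤ x ∧ x ≤ n := by
  rw [activeColumns, Finset.mem_image] at hx
  obtain ⟨j, -, rfl⟩ := hx
  exact ⟨by omega, j.isLt⟩

theorem card_activeColumns_le {M : Matrix (Fin m) (Fin n) ℤ} (hM : IsPASM M) (i : Fin m) :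
    (activeColumns M i).card ≤ i + 1 := by
  have h1 := card_filter_activeColumns hM i 0
  rw [Finset.filter_true_of_mem fun x hx => (mem_activeColumns hx).1] at h1
  have h2 := ((isDepth_cornerSum hM).bounds (i := i + 1) (j := n) i.isLt le_rfl).2.1
  simp only [Nat.sub_self] at h2
  omega

theorem monotone_pasmToTriangle {M : Matrix (Fin m) (Fin n) ℤ} (hM : IsPASM M) (i : Fin m) :
    Monotone (pasmToTriangle M i) := by
  have hlen : (List.replicate (i.val + 1 - (activeColumns M i).card) 0 ++
      (activeColumns M i).sort).length = i.val + 1 := by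
    have := card_activeColumns_le hM i
    simp only [List.length_append, List.length_replicate, Finset.length_sort]
    omega
  have hsort : (List.replicate (i.val + 1 - (activeColumns M i).card) 0 ++
      (activeColumns M i).sort).Pairwise (· ≤ ·) := by
    rw [List.pairwise_append]
    refine ⟨List.pairwise_replicate.2 (Or.inr le_rfl), Finset.pairwise_sort _ _,
      fun a ha b _ => ?_⟩
    rw [List.eq_of_mem_replicate ha]
    exact Nat.zero_le b
  intro j j' hjj
  rcases hjj.eq_or_lt with rfl | hlt
  · exact le_rfl
  · simp only [pasmToTriangle]
    rw [List.getD_eq_getElem _ _ (by omega), List.getD_eq_getElem _ _ (by omega)]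
    exact List.pairwise_iff_getElem.1 hsort _ _ _ _ hlt

theorem tailCount_pasmToTriangle {M : Matrix (Fin m) (Fin n) ℤ} (hM : IsPASM M) (i : Fin m)
    (c : ℕ) : (tailCount (pasmToTriangle M i) (c + 1) : ℤ) = cornerSum M (i + 1) c := by
  have hlen : (List.replicate (i.val + 1 - (activeColumns M i).card) 0 ++
      (activeColumns M i).sort).length = i.val + 1 := by
    have := card_activeColumns_le hM i
    simp only [List.length_append, List.length_replicate, Finset.length_sort]
    omega
  rw [← card_filter_activeColumns hM]
  have h1 := tailCount_getD _ hlen (c + 1)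
  have h2 : (activeColumns M i).sort.countP (c + 1 ≤ ·) =
      ((activeColumns M i).filter (c + 1 ≤ ·)).card := by
    rw [Finset.card_def, Finset.filter_val, ← Multiset.countP_eq_card_filter, ← Finset.sort_eq
      (activeColumns M i) (· ≤ ·), Multiset.coe_countP]
  rw [List.countP_append, List.countP_replicate, h2] at h1
  have h3 : tailCount (pasmToTriangle M i) (c + 1) = _ := h1
  rw [h3]
  simp

/-- Interlacing of two consecutive rows, in terms of counts. -/
theorem IsPartialMonotoneTriangle.tailCount_succ_row {a : TriangularArray m}
    (ha : IsPartialMonotoneTriangle m n a) (i : Fin m) (h : i.val + 1 < m) (c : ℕ) :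
    tailCount (a ⟨i.val + 1, h⟩) c = tailCount (a i) c ∨
      tailCount (a ⟨i.val + 1, h⟩) c = tailCount (a i) c + 1 := by
  have h1 := tailCount_le (a i) c
  have h2 := tailCount_le (a ⟨i.val + 1, h⟩) c
  simp only at h2
  have k1 := le_apply_iff_le_add_tailCount (ha.row_weak i) c
  have k2 := le_apply_iff_le_add_tailCount (ha.row_weak ⟨i.val + 1, h⟩) c
  have hle : tailCount (a i) c ≤ tailCount (a ⟨i.val + 1, h⟩) c := by
    by_contra hlt
    have e1 := (k1 ⟨i.val + 1 - tailCount (a i) c, by omega⟩).2 (by simp only; omega)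
    have e2 := (k2 _).1 (e1.trans (ha.diag_down i h _))
    simp only [Fin.val_succ] at e2
    omega
  have hge : tailCount (a ⟨i.val + 1, h⟩) c ≤ tailCount (a i) c + 1 := by
    by_contra hlt
    have e1 := (k2 (Fin.castSucc (⟨i.val + 2 - tailCount (a ⟨i.val + 1, h⟩) c, by omega⟩ :
      Fin (i.val + 1)))).2
      (by
        change i.val + 2 ≤ i.val + 2 - tailCount (a ⟨i.val + 1, h⟩) c +
          tailCount (a ⟨i.val + 1, h⟩) c
        omega)
    have e2 := (k1 _).1 (e1.trans (ha.diag_up i h _))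
    simp only at e2
    omega
  omega

/-- Each positive number occurs at most once in a row. -/
theorem IsPartialMonotoneTriangle.tailCount_succ {a : TriangularArray m}
    (ha : IsPartialMonotoneTriangle m n a) (i : Fin m) (c : ℕ) :
    tailCount (a i) (c + 1) = tailCount (a i) (c + 2) ∨
      tailCount (a i) (c + 1) = tailCount (a i) (c + 2) + 1 := by
  have h0 := tailCount_antitone (a i) (by omega : c + 1 ≤ c + 2)
  have h1 := tailCount_le (a i) (c + 1)
  have k := le_apply_iff_le_add_tailCount (ha.row_weak i)
  by_contra hne
  have e1 := (k (c + 1) ⟨i.val + 1 - tailCount (a i) (c + 1), by omega⟩).2 (by simp only; omega)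
  have hlt : (⟨i.val + 1 - tailCount (a i) (c + 1), by omega⟩ : Fin (i.val + 1)) <
      ⟨i.val + 2 - tailCount (a i) (c + 1), by omega⟩ := by
    rw [Fin.lt_def]
    simp only
    omega
  have e2 := ha.row_weak i hlt.le
  have e3 := ha.row_strict i _ _ hlt (by omega) (by omega)
  have e4 := (k (c + 2) ⟨i.val + 2 - tailCount (a i) (c + 1), by omega⟩).1 (by omega)
  simp only at e4
  omega

theorem IsPartialMonotoneTriangle.tailCount_eq_zero {a : TriangularArray m}
    (ha : IsPartialMonotoneTriangle m n a) (i : Fin m) {c : ℕ} (hc : n < c) :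
    tailCount (a i) c = 0 := by
  rw [tailCount, Finset.card_eq_zero, Finset.filter_eq_empty_iff]
  intro j _
  have := ha.entries i j
  omega

theorem isPartialMonotoneTriangle_pasmToTriangle {M : Matrix (Fin m) (Fin n) ℤ} (hM : IsPASM M) :
    IsPartialMonotoneTriangle m n (pasmToTriangle M) := by
  have hmono := monotone_pasmToTriangle hM
  have htc := tailCount_pasmToTriangle hM
  have k := fun i => le_apply_iff_le_add_tailCount (hmono i)
  obtain ⟨hr, hc⟩ := (isPASM_iff M).1 hM
  generalize pasmToTriangle M = a at *
  refine ⟨fun i j => ?_, hmono, fun i j j' hj h1 h2 => ?_, fun i h j => ?_, fun i h j => ?_⟩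
  · by_contra hlt
    have e1 := (k i (n + 1) j).1 (by omega)
    have e2 := htc i n
    rw [cornerSum_of_le M _ le_rfl] at e2
    omega
  · by_contra hlt
    obtain ⟨c, hcj⟩ := Nat.exists_eq_succ_of_ne_zero h1
    have e1 := (k i (c + 1) j).1 hcj.ge
    have e2 := mt (k i (c + 2) j').2 (by omega)
    have e3 := htc i c
    have e4 : (tailCount (a i) (c + 2) : ℤ) = _ := htc i (c + 1)
    have hj' : j.val < j'.val := hj
    by_cases hcn : c < n
    · have e5 := cornerSum_eq_add M (i + 1) ⟨c, hcn⟩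
      have e6 := hc ⟨c, hcn⟩ (i + 1)
      simp only at e5
      omega
    · rw [cornerSum_of_le M _ (by omega)] at e3
      omega
  · rcases hv : a ⟨i.val + 1, h⟩ j.castSucc with _ | c
    · exact Nat.zero_le _
    · have e1 := (k _ (c + 1) _).1 hv.ge
      have e2 := htc i c
      have e3 := htc ⟨i.val + 1, h⟩ c
      have e4 := cornerSum_succ M ⟨i.val + 1, h⟩ c
      have e5 := hr ⟨i.val + 1, h⟩ c
      simp only [Fin.val_castSucc] at e1 e3 e4
      exact (k i (c + 1) j).2 (by omega)
  · rcases hv : a i j with _ | c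
    · exact Nat.zero_le _
    · have e1 := (k _ (c + 1) _).1 hv.ge
      have e2 := htc i c
      have e3 := htc ⟨i.val + 1, h⟩ c
      have e4 := cornerSum_succ M ⟨i.val + 1, h⟩ c
      have e5 := hr ⟨i.val + 1, h⟩ c
      simp only at e3 e4
      exact (k ⟨i.val + 1, h⟩ (c + 1) j.succ).2 (by simp only [Fin.val_succ]; omega)

theorem bijOn_pasmToTriangle :
    Set.BijOn (pasmToTriangle (m := m) (n := n)) (PASM m n) (PartialMonotoneTriangles m n) := by
  refine ⟨fun M hM => isPartialMonotoneTriangle_pasmToTriangle hM, fun M hM M' hM' h => ?_,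
    fun a ha => ?_⟩
  · refine eq_of_cornerSum_eq fun i hi j _ => ?_
    cases i with
    | zero => rw [cornerSum_zero, cornerSum_zero]
    | succ i =>
      have e1 := tailCount_pasmToTriangle hM ⟨i, hi⟩ j
      have e2 := tailCount_pasmToTriangle hM' ⟨i, hi⟩ j
      rw [h, e2] at e1
      exact e1.symm
  · have ha : IsPartialMonotoneTriangle m n a := ha
    let c : ℕ → ℕ → ℤ := fun i j =>
      if h : 0 < i ∧ i ≤ m then tailCount (a ⟨i - 1, by omega⟩) (j + 1) else 0
    have c_zero : ∀ j, c 0 j = 0 := fun j => dif_neg (by omega)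
    have c_succ : ∀ i (hi : i < m) j, c (i + 1) j = tailCount (a ⟨i, hi⟩) (j + 1) :=
      fun i hi j => dif_pos ⟨by omega, hi⟩
    obtain ⟨M, hM, hMc⟩ := exists_mem_PASM_of_cornerSum (m := m) (n := n) c (fun j _ => c_zero j)
      (fun i hi => by
        cases i with
        | zero => exact c_zero n
        | succ i => rw [c_succ i hi, ha.tailCount_eq_zero _ (by omega), Nat.cast_zero])
      (fun i hi j hj => by
        rw [c_succ i hi]
        cases i with
        | zero =>
          have := tailCount_le (a ⟨0, hi⟩) (j + 1)
          rw [c_zero]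
          simp only at this
          omega
        | succ i =>
          have := ha.tailCount_succ_row ⟨i, by omega⟩ hi (j + 1)
          rw [c_succ i (by omega)]
          simp only at this
          omega)
      (fun i hi j hj => by
        cases i with
        | zero => exact Or.inl ((c_zero _).trans (c_zero _).symm)
        | succ i =>
          have := ha.tailCount_succ ⟨i, hi⟩ j
          rw [c_succ i hi, c_succ i hi, Nat.cast_inj]
          exact_mod_cast this)
    refine ⟨M, hM, funext fun i => ?_⟩
    refine eq_of_tailCount_eq (monotone_pasmToTriangle hM i) (ha.row_weak i) fun j => ?_
    have e := tailCount_pasmToTriangle hM i j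
    by_cases hj : j ≤ n
    · rw [hMc _ i.isLt _ hj, c_succ i i.isLt] at e
      exact_mod_cast e
    · rw [cornerSum_of_le M _ (by omega)] at e
      rw [ha.tailCount_eq_zero i (by omega)]
      exact_mod_cast e

/-! ### The grid graph -/

namespace GridVertex

theorem ext_row_col {u v : GridVertex m n} (hr : u.row = v.row) (hc : u.col = v.col) : u = v :=
  Subtype.ext (Prod.ext hr hc)

theorem not_isEven_iff {v : GridVertex m n} : ¬v.IsEven ↔ v.IsOdd := Nat.not_even_iff_odd

theorem not_isOdd_iff {v : GridVertex m n} : ¬v.IsOdd ↔ v.IsEven := Nat.not_odd_iff_even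

theorem bounds (v : GridVertex m n) : v.row ≤ m + 1 ∧ v.col ≤ n + 1 ∧
    ¬((v.row = 0 ∨ v.row = m + 1) ∧ (v.col = 0 ∨ v.col = n + 1)) :=
  v.2

theorem exists_row_col {i j : ℕ} (h : i ≤ m + 1 ∧ j ≤ n + 1 ∧
    ¬((i = 0 ∨ i = m + 1) ∧ (j = 0 ∨ j = n + 1))) : ∃ v : GridVertex m n, v.row = i ∧ v.col = j :=
  ⟨⟨(i, j), h⟩, rfl, rfl⟩

end GridVertex

theorem gridGraph_adj {u v : GridVertex m n} :
    (gridGraph m n).Adj u v ↔ GridEdge u v ∨ GridEdge v u := by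
  rw [gridGraph, SimpleGraph.fromRel_adj, and_iff_right_iff_imp]
  rintro h rfl
  rw [or_self] at h
  rcases h with ⟨h, -⟩ | ⟨-, h, -⟩ <;> omega

theorem GridEdge.adj {u v : GridVertex m n} (h : GridEdge u v) : (gridGraph m n).Adj u v :=
  gridGraph_adj.2 (Or.inl h)

theorem isOdd_iff_isEven_of_adj {u v : GridVertex m n} (h : (gridGraph m n).Adj u v) :
    v.IsOdd ↔ u.IsEven := by
  rw [GridVertex.IsOdd, GridVertex.IsEven, Nat.odd_iff, Nat.even_iff]
  rcases gridGraph_adj.1 h with (⟨h1, h2, -⟩ | ⟨h1, h2, -⟩) | ⟨h1, h2, -⟩ | ⟨h1, h2, -⟩ <;> omega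

/-- An internal vertex has four neighbors `a`, `b`, `c`, `d`. The number of neighbors with a
property `P` is a sum of four numbers `0` or `1`. -/
theorem exists_neighbors {v : GridVertex m n} (hv : v.IsInternal) :
    ∃ a b c d : GridVertex m n,
      (a.row + 1 = v.row ∧ a.col = v.col) ∧ (b.row = v.row + 1 ∧ b.col = v.col) ∧
      (c.row = v.row ∧ c.col + 1 = v.col) ∧ (d.row = v.row ∧ d.col = v.col + 1) ∧
      (gridGraph m n).Adj v a ∧ (gridGraph m n).Adj v b ∧
      (gridGraph m n).Adj v c ∧ (gridGraph m n).Adj v d ∧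
      ∀ P : GridVertex m n → Prop, (∀ u, P u → (gridGraph m n).Adj v u) →
        ∃ xa xb xc xd : ℕ, {u | P u}.ncard = xa + xb + xc + xd ∧ (xa ≤ 1 ∧ (xa = 1 ↔ P a)) ∧
          (xb ≤ 1 ∧ (xb = 1 ↔ P b)) ∧ (xc ≤ 1 ∧ (xc = 1 ↔ P c)) ∧ (xd ≤ 1 ∧ (xd = 1 ↔ P d)) := by
  classical
  obtain ⟨h1, h2, h3, h4⟩ := hv
  obtain ⟨a, ha1, ha2⟩ := GridVertex.exists_row_col (m := m) (n := n) (i := v.row - 1) (j := v.col)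
    (by omega)
  obtain ⟨b, hb1, hb2⟩ := GridVertex.exists_row_col (m := m) (n := n) (i := v.row + 1) (j := v.col)
    (by omega)
  obtain ⟨c, hc1, hc2⟩ := GridVertex.exists_row_col (m := m) (n := n) (i := v.row) (j := v.col - 1)
    (by omega)
  obtain ⟨d, hd1, hd2⟩ := GridVertex.exists_row_col (m := m) (n := n) (i := v.row) (j := v.col + 1)
    (by omega)
  refine ⟨a, b, c, d, by omega, by omega, by omega, by omega,
    gridGraph_adj.2 (Or.inr (Or.inl (by omega))), gridGraph_adj.2 (Or.inl (Or.inl (by omega))),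
    gridGraph_adj.2 (Or.inr (Or.inr (by omega))), gridGraph_adj.2 (Or.inl (Or.inr (by omega))),
    fun P hP => ?_⟩
  have hne : ∀ {x y : GridVertex m n}, (x.row ≠ y.row ∨ x.col ≠ y.col) → x ≠ y := by
    rintro x y h rfl
    simp at h
  have hset : {u | P u} = ((({a, b, c, d} : Finset (GridVertex m n)).filter P :
      Finset (GridVertex m n)) : Set (GridVertex m n)) := by
    ext u
    simp only [Set.mem_ofPred_eq, Finset.coe_filter, Finset.mem_insert, Finset.mem_singleton]
    refine ⟨fun hu => ⟨?_, hu⟩, fun hu => hu.2⟩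
    rcases gridGraph_adj.1 (hP u hu) with (h | h) | h | h
    · exact Or.inr (Or.inl (GridVertex.ext_row_col (by omega) (by omega)))
    · exact Or.inr (Or.inr (Or.inr (GridVertex.ext_row_col (by omega) (by omega))))
    · exact Or.inl (GridVertex.ext_row_col (by omega) (by omega))
    · exact Or.inr (Or.inr (Or.inl (GridVertex.ext_row_col (by omega) (by omega))))
  have hind : ∀ u, (if P u then 1 else 0) ≤ 1 ∧ ((if P u then 1 else 0) = 1 ↔ P u) := by
    intro u
    split_ifs with h <;> simp [h]
  refine ⟨_, _, _, _, ?_, hind a, hind b, hind c, hind d⟩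
  rw [hset, Set.ncard_coe_finset, Finset.card_filter, Finset.sum_insert, Finset.sum_insert,
    Finset.sum_insert, Finset.sum_singleton]
  · ring
  · simp only [Finset.mem_singleton]
    exact hne (by omega)
  · simp only [Finset.mem_insert, Finset.mem_singleton, not_or]
    exact ⟨hne (by omega), hne (by omega)⟩
  · simp only [Finset.mem_insert, Finset.mem_singleton, not_or]
    exact ⟨hne (by omega), hne (by omega), hne (by omega)⟩

theorem gridGraph_adj_of_top {u v : GridVertex m n} (hu : u.row = 0) (hv : v.row = 1)
    (h : u.col = v.col) : (gridGraph m n).Adj u v := by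
  have := u.bounds
  exact GridEdge.adj (Or.inl (by omega))

theorem gridGraph_adj_of_left {u v : GridVertex m n} (hu : u.col = 0) (hv : v.col = 1)
    (h : u.row = v.row) : (gridGraph m n).Adj u v := by
  have := u.bounds
  exact GridEdge.adj (Or.inr (by omega))

/-! ### Ice configurations and fully-packed loops -/

theorem IsRectangularIce.iceToFPL_adj_of_isEven {D : Digraph (GridVertex m n)}
    (hD : IsRectangularIce D) {u : GridVertex m n} (hu : u.IsEven) (v : GridVertex m n) :
    (iceToFPL D).Adj u v ↔ D.Adj u v := by
  rw [iceToFPL, SimpleGraph.fromRel_adj]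
  constructor
  · rintro ⟨-, ⟨h, -⟩ | ⟨-, -, h⟩⟩
    · exact h
    · exact absurd hu (GridVertex.not_isEven_iff.2 h)
  · intro h
    have hadj := (hD.underlying u v).1 (Or.inl h)
    exact ⟨hadj.ne, Or.inl ⟨h, hu, (isOdd_iff_isEven_of_adj hadj).2 hu⟩⟩

theorem IsRectangularIce.iceToFPL_adj_of_isOdd {D : Digraph (GridVertex m n)}
    (hD : IsRectangularIce D) {u : GridVertex m n} (hu : u.IsOdd) (v : GridVertex m n) :
    (iceToFPL D).Adj u v ↔ D.Adj v u := by
  rw [iceToFPL, SimpleGraph.fromRel_adj]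
  constructor
  · rintro ⟨-, ⟨-, h, -⟩ | ⟨h, -⟩⟩
    · exact absurd hu (GridVertex.not_isOdd_iff.2 h)
    · exact h
  · intro h
    have hadj := (hD.underlying v u).1 (Or.inl h)
    exact ⟨hadj.ne', Or.inr ⟨h, (isOdd_iff_isEven_of_adj hadj).1 hu, hu⟩⟩

theorem IsRectangularIce.isPartialFPL {D : Digraph (GridVertex m n)} (hD : IsRectangularIce D) :
    IsPartialFPL (iceToFPL D) where
  le_grid u v h := by
    rw [← hD.underlying]
    by_cases hu : u.IsEven
    · exact Or.inl ((hD.iceToFPL_adj_of_isEven hu v).1 h)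
    · exact Or.inr ((hD.iceToFPL_adj_of_isOdd (GridVertex.not_isEven_iff.1 hu) v).1 h)
  top u v hu hv huv := by
    have h := hD.top u v hu hv huv
    by_cases hc : Odd u.col
    · have hodd : u.IsOdd := by rwa [GridVertex.IsOdd, hu, zero_add]
      exact iff_of_true ((hD.iceToFPL_adj_of_isOdd hodd v).2 h) hc
    · have heven : u.IsEven := by rwa [GridVertex.IsEven, hu, zero_add, ← Nat.not_odd_iff_even]
      exact iff_of_false (fun h' => hD.oriented u v
        ⟨(hD.iceToFPL_adj_of_isEven heven v).1 h', h⟩) hc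
  left u v hu hv huv := by
    have h := hD.left u v hu hv huv
    by_cases hc : Even u.row
    · have heven : u.IsEven := by rwa [GridVertex.IsEven, hu, add_zero]
      exact iff_of_true ((hD.iceToFPL_adj_of_isEven heven v).2 h) hc
    · have hodd : u.IsOdd := by rwa [GridVertex.IsOdd, hu, add_zero, ← Nat.not_even_iff_odd]
      exact iff_of_false (fun h' => hD.oriented u v
        ⟨h, (hD.iceToFPL_adj_of_isOdd hodd v).1 h'⟩) hc
  degree v hv := by
    by_cases he : v.IsEven
    · rw [← hD.out_degree v hv]
      congr 1
      ext u
      exact hD.iceToFPL_adj_of_isEven he u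
    · rw [← hD.in_degree v hv]
      congr 1
      ext u
      exact hD.iceToFPL_adj_of_isOdd (GridVertex.not_isEven_iff.1 he) u

/-- The orientation of the grid graph in which the edges of `H` are directed from even to odd
vertices, and all other edges from odd to even vertices. -/
def fplToIce (H : SimpleGraph (GridVertex m n)) : Digraph (GridVertex m n) where
  Adj u v := (gridGraph m n).Adj u v ∧ (H.Adj u v ↔ u.IsEven)

theorem IsRectangularIce.fplToIce_iceToFPL {D : Digraph (GridVertex m n)}
    (hD : IsRectangularIce D) : fplToIce (iceToFPL D) = D := by
  ext u v
  have h1 := hD.underlying u v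
  have h2 := hD.oriented u v
  change _ ∧ _ ↔ _
  by_cases hu : u.IsEven
  · rw [hD.iceToFPL_adj_of_isEven hu]
    tauto
  · rw [hD.iceToFPL_adj_of_isOdd (GridVertex.not_isEven_iff.1 hu)]
    tauto

theorem iceToFPL_fplToIce {H : SimpleGraph (GridVertex m n)} (hH : H ≤ gridGraph m n) :
    iceToFPL (fplToIce H) = H := by
  ext u v
  rw [iceToFPL, SimpleGraph.fromRel_adj]
  have h3 := H.adj_comm u v
  have h5 := (gridGraph m n).adj_comm u v
  change _ ∧ ((((gridGraph m n).Adj u v ∧ (H.Adj u v ↔ u.IsEven)) ∧ _) ∨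
    (((gridGraph m n).Adj v u ∧ (H.Adj v u ↔ v.IsEven)) ∧ _)) ↔ _
  constructor
  · tauto
  · intro h
    have hadj := hH h
    have h4 := isOdd_iff_isEven_of_adj hadj
    refine ⟨hadj.ne, ?_⟩
    by_cases hu : u.IsEven
    · exact Or.inl ⟨⟨hadj, iff_of_true h hu⟩, hu, h4.2 hu⟩
    · have hv := GridVertex.not_isOdd_iff.1 (mt h4.1 hu)
      exact Or.inr ⟨⟨hadj.symm, iff_of_true h.symm hv⟩, hv, GridVertex.not_isEven_iff.1 hu⟩

theorem ncard_compl_neighborSet {H : SimpleGraph (GridVertex m n)} (hH : H ≤ gridGraph m n)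
    {v : GridVertex m n} (hv : v.IsInternal) :
    {u | (gridGraph m n).Adj v u ∧ ¬H.Adj v u}.ncard + (H.neighborSet v).ncard = 4 := by
  obtain ⟨a, b, c, d, -, -, -, -, ha, hb, hc, hd, hcard⟩ := exists_neighbors hv
  have h1 : ((gridGraph m n).neighborSet v).ncard = 4 := by
    obtain ⟨xa, xb, xc, xd, h, hxa, hxb, hxc, hxd⟩ :=
      hcard (fun u => (gridGraph m n).Adj v u) fun u hu => hu
    change {u | (gridGraph m n).Adj v u}.ncard = 4
    rw [h, hxa.2.2 ha, hxb.2.2 hb, hxc.2.2 hc, hxd.2.2 hd]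
  rw [← h1]
  have hfin : ((gridGraph m n).neighborSet v).Finite :=
    Set.finite_of_ncard_ne_zero (by rw [h1]; decide)
  exact Set.ncard_sdiff_add_ncard_of_subset (fun u hu => hH hu) hfin

theorem IsPartialFPL.isRectangularIce {H : SimpleGraph (GridVertex m n)} (hH : IsPartialFPL H) :
    IsRectangularIce (fplToIce H) := by
  classical
  have hout : ∀ v : GridVertex m n, ∀ u, (fplToIce H).Adj v u ↔
      if v.IsEven then H.Adj v u else (gridGraph m n).Adj v u ∧ ¬H.Adj v u := by
    intro v u
    have := @hH.le_grid v u
    change _ ∧ _ ↔ _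
    split_ifs with hv <;> tauto
  have hin : ∀ v : GridVertex m n, ∀ u, (fplToIce H).Adj u v ↔
      if v.IsEven then (gridGraph m n).Adj v u ∧ ¬H.Adj v u else H.Adj v u := by
    intro v u
    have h1 := @hH.le_grid v u
    change _ ∧ _ ↔ _
    rw [SimpleGraph.adj_comm, H.adj_comm]
    by_cases hadj : (gridGraph m n).Adj v u
    · have h2 := isOdd_iff_isEven_of_adj hadj
      rw [← GridVertex.not_isEven_iff] at h2
      split_ifs with hv <;> tauto
    · split_ifs with hv <;> tauto
  have h4 := fun v : GridVertex m n => ncard_compl_neighborSet hH.le_grid (v := v)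
  refine ⟨fun u v => ?_, fun u v => ?_, fun u v hu hv huv => ?_, fun u v hu hv huv => ?_,
    fun v hv => ?_, fun v hv => ?_⟩
  · have := @hH.le_grid u v
    rw [hin u v, hout u v]
    split_ifs <;> tauto
  · rw [hin u v, hout u v]
    split_ifs <;> tauto
  · refine ⟨gridGraph_adj_of_left hu hv huv, ?_⟩
    rw [hH.left u v hu hv huv, GridVertex.IsEven, hu, add_zero]
  · refine ⟨(gridGraph_adj_of_top hu hv huv).symm, ?_⟩
    rw [H.adj_comm, hH.top u v hu hv huv, GridVertex.IsEven, hv, ← huv, Nat.odd_iff, Nat.even_iff]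
    omega
  · have h5 := hH.degree v hv
    have h6 := h4 v hv
    simp only [hin v]
    split_ifs
    · omega
    · exact h5
  · have h5 := hH.degree v hv
    have h6 := h4 v hv
    simp only [hout v]
    split_ifs
    · exact h5
    · omega

theorem bijOn_iceToFPL :
    Set.BijOn (iceToFPL (m := m) (n := n)) (RectangularIce m n) (PartialFPLs m n) :=
  Set.InvOn.bijOn (f' := fplToIce)
    ⟨fun _ hD => IsRectangularIce.fplToIce_iceToFPL hD,
      fun _ hH => iceToFPL_fplToIce (IsPartialFPL.le_grid hH)⟩
    (fun _ hD => IsRectangularIce.isPartialFPL hD)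
    fun _ hH => IsPartialFPL.isRectangularIce hH

/-! ### Height functions and fully-packed loops -/

theorem exists_indicator_iff (P Q : ℕ → ℕ → Prop) :
    ∃ x : ℕ → ℕ → ℤ, ∀ i j, (x i j = 0 ∨ x i j = 1) ∧ (P i j ↔ (x i j = 0 ↔ Q i j)) := by
  classical
  refine ⟨fun i j => if (P i j ↔ Q i j) then 0 else 1, fun i j => ?_⟩
  by_cases hP : P i j <;> by_cases hQ : Q i j <;> simp [hP, hQ]

/-- The edges at a vertex in terms of the steps `x`, `x'`, `y`, `y'` of the depth function across
them: two of the four edges are present exactly if the steps around the vertex add up to zero. -/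
theorem add_eq_two_iff {p xa xb xc xd : ℕ} {x x' y y' : ℤ} (hx : x = 0 ∨ x = 1)
    (hx' : x' = 0 ∨ x' = 1) (hy : y = 0 ∨ y = 1) (hy' : y' = 0 ∨ y' = 1)
    (ha : xa ≤ 1 ∧ (xa = 1 ↔ (x = 0 ↔ p % 2 = 0)))
    (hb : xb ≤ 1 ∧ (xb = 1 ↔ (x' = 0 ↔ (p + 1) % 2 = 0)))
    (hc : xc ≤ 1 ∧ (xc = 1 ↔ (y = 0 ↔ p % 2 = 1)))
    (hd : xd ≤ 1 ∧ (xd = 1 ↔ (y' = 0 ↔ (p + 1) % 2 = 1))) :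
    xa + xb + xc + xd = 2 ↔ x + y' = y + x' := by
  obtain hp | hp := Nat.mod_two_eq_zero_or_one p
  · have ha' : (xa : ℤ) = 1 - x := by omega
    have hb' : (xb : ℤ) = x' := by omega
    have hc' : (xc : ℤ) = y := by omega
    have hd' : (xd : ℤ) = 1 - y' := by omega
    omega
  · have ha' : (xa : ℤ) = x := by omega
    have hb' : (xb : ℤ) = 1 - x' := by omega
    have hc' : (xc : ℤ) = 1 - y := by omega
    have hd' : (xd : ℤ) = y' := by omega
    omega

theorem heightToFPL_le_gridGraph (h : Matrix (Fin (m + 1)) (Fin (n + 1)) ℤ) :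
    heightToFPL h ≤ gridGraph m n := by
  have key : ∀ u v : GridVertex m n, DrawnEdge h u v → GridEdge u v := by
    rintro u v (⟨i, j, k, h1, h2, h3, h4, -⟩ | ⟨i, j, k, h1, h2, h3, h4, -⟩)
    · exact Or.inl (by omega)
    · exact Or.inr (by omega)
  intro u v huv
  rw [heightToFPL, SimpleGraph.fromRel_adj] at huv
  exact gridGraph_adj.2 (huv.2.imp (key u v) (key v u))

section

variable {t : ℕ → ℕ → ℤ} {h : Matrix (Fin (m + 1)) (Fin (n + 1)) ℤ}

theorem IsDepth.heightToFPL_adj_vertical (ht : IsDepth m n t)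
    (hh : ∀ i j, h i j = i.val + j.val - 2 * t i j) {u v : GridVertex m n} {i j : ℕ} (hi : i ≤ m)
    (hj : j < n) (hu : u.row = i ∧ u.col = j + 1) (hv : v.row = i + 1 ∧ v.col = j + 1) :
    (heightToFPL h).Adj u v ↔ (t i (j + 1) - t i j = 0 ↔ (i + j) % 2 = 0) := by
  rw [heightToFPL, SimpleGraph.fromRel_adj]
  constructor
  · rintro ⟨-, (⟨i', j', k, h1, h2, h3, h4, h5⟩ | ⟨i', j', k, h1, h2, h3, h4, -⟩) |
      ⟨i', j', k, h1, h2, h3, h4, -⟩ | ⟨i', j', k, h1, h2, h3, h4, -⟩⟩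
    · obtain rfl : i'.val = i := by omega
      obtain rfl : j'.val = j := by omega
      rw [hh, hh, Fin.val_castSucc, Fin.val_succ] at h5
      push_cast at h5
      omega
    · omega
    · omega
    · omega
  · intro hiff
    refine ⟨fun huv => ?_, Or.inl (Or.inl ⟨⟨i, by omega⟩, ⟨j, hj⟩, ((i + j) / 2 : ℕ) - t i j,
      hu.1, hu.2, hv.1, hv.2, ?_⟩)⟩
    · rw [huv] at hu
      omega
    · have := ht.row_step i hi j hj
      rw [hh, hh, Fin.val_castSucc, Fin.val_succ]
      push_cast
      omega

theorem IsDepth.heightToFPL_adj_horizontal (ht : IsDepth m n t)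
    (hh : ∀ i j, h i j = i.val + j.val - 2 * t i j) {u v : GridVertex m n} {i j : ℕ} (hi : i < m)
    (hj : j ≤ n) (hu : u.row = i + 1 ∧ u.col = j) (hv : v.row = i + 1 ∧ v.col = j + 1) :
    (heightToFPL h).Adj u v ↔ (t (i + 1) j - t i j = 0 ↔ (i + j) % 2 = 1) := by
  rw [heightToFPL, SimpleGraph.fromRel_adj]
  constructor
  · rintro ⟨-, (⟨i', j', k, h1, h2, h3, h4, -⟩ | ⟨i', j', k, h1, h2, h3, h4, h5⟩) |
      ⟨i', j', k, h1, h2, h3, h4, -⟩ | ⟨i', j', k, h1, h2, h3, h4, -⟩⟩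
    · omega
    · obtain rfl : i'.val = i := by omega
      obtain rfl : j'.val = j := by omega
      rw [hh, hh, Fin.val_castSucc, Fin.val_succ] at h5
      push_cast at h5
      omega
    · omega
    · omega
  · intro hiff
    refine ⟨fun huv => ?_, Or.inl (Or.inr ⟨⟨i, hi⟩, ⟨j, by omega⟩,
      ((i + j + 1) / 2 : ℕ) - t i j, hu.1, hu.2, hv.1, hv.2, ?_⟩)⟩
    · rw [huv] at hu
      omega
    · have := ht.col_step i hi j hj
      rw [hh, hh, Fin.val_castSucc, Fin.val_succ]
      push_cast
      omega

theorem IsDepth.isPartialFPL_heightToFPL (ht : IsDepth m n t)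
    (hh : ∀ i j, h i j = i.val + j.val - 2 * t i j) : IsPartialFPL (heightToFPL h) where
  le_grid := heightToFPL_le_gridGraph h
  top u v hu hv huv := by
    have := u.bounds
    obtain ⟨j, hj⟩ : ∃ j, u.col = j + 1 := ⟨u.col - 1, by omega⟩
    rw [ht.heightToFPL_adj_vertical hh (Nat.zero_le m) (by omega : j < n) (by omega) (by omega),
      ht.first_row _ (by omega), ht.first_row _ (by omega), Nat.odd_iff]
    omega
  left u v hu hv huv := by
    have := u.bounds
    obtain ⟨i, hi⟩ : ∃ i, u.row = i + 1 := ⟨u.row - 1, by omega⟩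
    rw [ht.heightToFPL_adj_horizontal hh (by omega : i < m) (Nat.zero_le n) (by omega) (by omega),
      ht.first_col _ (by omega), ht.first_col _ (by omega), Nat.even_iff]
    omega
  degree v hv := by
    obtain ⟨a, b, c, d, ha, hb, hc, hd, -, -, -, -, hcard⟩ := exists_neighbors hv
    obtain ⟨hv1, hv2, hv3, hv4⟩ := hv
    obtain ⟨i, hi⟩ : ∃ i, v.row = i + 1 := ⟨v.row - 1, by omega⟩
    obtain ⟨j, hj⟩ : ∃ j, v.col = j + 1 := ⟨v.col - 1, by omega⟩
    obtain ⟨xa, xb, xc, xd, hsum, hxa, hxb, hxc, hxd⟩ :=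
      hcard (fun u => (heightToFPL h).Adj v u) fun u hu => heightToFPL_le_gridGraph h hu
    change {u | (heightToFPL h).Adj v u}.ncard = 2
    have ea := ht.heightToFPL_adj_vertical hh (u := a) (v := v) (i := i) (j := j)
      (by omega) (by omega) (by omega) (by omega)
    have eb := ht.heightToFPL_adj_vertical hh (u := v) (v := b) (i := i + 1) (j := j)
      (by omega) (by omega) (by omega) (by omega)
    have ec := ht.heightToFPL_adj_horizontal hh (u := c) (v := v) (i := i) (j := j)
      (by omega) (by omega) (by omega) (by omega)
    have ed := ht.heightToFPL_adj_horizontal hh (u := v) (v := d) (i := i) (j := j + 1)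
      (by omega) (by omega) (by omega) (by omega)
    rw [SimpleGraph.adj_comm] at ea ec
    have s1 := ht.row_step i (by omega) j (by omega)
    have s2 := ht.row_step (i + 1) (by omega) j (by omega)
    have s3 := ht.col_step i (by omega) j (by omega)
    have s4 := ht.col_step i (by omega) (j + 1) (by omega)
    rw [ea] at hxa
    rw [eb, Nat.add_right_comm] at hxb
    rw [ec] at hxc
    rw [ed, ← Nat.add_assoc] at hxd
    rw [hsum, add_eq_two_iff (by omega) (by omega) (by omega) (by omega) hxa hxb hxc hxd]
    ring

end

/-- A spanning subgraph of the grid graph is determined by its edges `v_{i,j+1} v_{i+1,j+1}` and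
`v_{i+1,j} v_{i+1,j+1}`. -/
theorem eq_of_le_gridGraph {H H' : SimpleGraph (GridVertex m n)} (hH : H ≤ gridGraph m n)
    (hH' : H' ≤ gridGraph m n)
    (hvert : ∀ u v : GridVertex m n, ∀ i ≤ m, ∀ j < n, u.row = i ∧ u.col = j + 1 →
      v.row = i + 1 ∧ v.col = j + 1 → (H.Adj u v ↔ H'.Adj u v))
    (hhor : ∀ u v : GridVertex m n, ∀ i < m, ∀ j ≤ n, u.row = i + 1 ∧ u.col = j →
      v.row = i + 1 ∧ v.col = j + 1 → (H.Adj u v ↔ H'.Adj u v)) : H = H' := by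
  have key : ∀ u v : GridVertex m n, GridEdge u v → (H.Adj u v ↔ H'.Adj u v) := by
    intro u v huv
    have := u.bounds
    have := v.bounds
    rcases huv with huv | huv
    · exact hvert u v u.row (by omega) (u.col - 1) (by omega) (by omega) (by omega)
    · exact hhor u v (u.row - 1) (by omega) u.col (by omega) (by omega) (by omega)
  ext u v
  by_cases hadj : (gridGraph m n).Adj u v
  · rcases gridGraph_adj.1 hadj with huv | huv
    · exact key u v huv
    · rw [H.adj_comm, H'.adj_comm]
      exact key v u huv
  · exact iff_of_false (fun h => hadj (hH h)) fun h => hadj (hH' h)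

theorem injOn_heightToFPL :
    Set.InjOn (heightToFPL (m := m) (n := n)) (PartialHeightFunctions m n) := by
  intro h hh h' hh' heq
  obtain ⟨t, ht, htt⟩ := IsPartialHeightFunction.exists_isDepth hh
  obtain ⟨t', ht', htt'⟩ := IsPartialHeightFunction.exists_isDepth hh'
  have key : ∀ i ≤ m, ∀ j ≤ n, t i j = t' i j := by
    intro i hi j hj
    induction j with
    | zero => rw [ht.first_col i hi, ht'.first_col i hi]
    | succ j ih =>
      have := ih (by omega)
      obtain ⟨u, hu⟩ := GridVertex.exists_row_col (m := m) (n := n) (i := i) (j := j + 1) (by omega)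
      obtain ⟨v, hv⟩ := GridVertex.exists_row_col (m := m) (n := n) (i := i + 1) (j := j + 1)
        (by omega)
      have e1 := ht.heightToFPL_adj_vertical htt hi hj hu hv
      have e2 := ht'.heightToFPL_adj_vertical htt' hi hj hu hv
      rw [heq, e2] at e1
      have s1 := ht.row_step i hi j hj
      have s2 := ht'.row_step i hi j hj
      omega
  ext i j
  rw [htt, htt', key i (by omega) j (by omega)]

/-- The horizontal steps `x` and the vertical steps `y` of a depth function can be prescribed, if
they agree around each square. -/
theorem exists_isDepth_of_steps (x y : ℕ → ℕ → ℤ)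
    (hx : ∀ i ≤ m, ∀ j < n, x i j = 0 ∨ x i j = 1) (hy : ∀ i < m, ∀ j ≤ n, y i j = 0 ∨ y i j = 1)
    (hx0 : ∀ j < n, x 0 j = 0) (hy0 : ∀ i < m, y i 0 = 0)
    (hxy : ∀ i < m, ∀ j < n, x i j + y i (j + 1) = y i j + x (i + 1) j) :
    ∃ t, IsDepth m n t ∧ (∀ i j, t i (j + 1) = t i j + x i j) ∧
      ∀ i < m, ∀ j ≤ n, t (i + 1) j = t i j + y i j := by
  let t : ℕ → ℕ → ℤ := fun i j => ∑ j' ∈ Finset.range j, x i j'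
  have h1 : ∀ i j, t i (j + 1) = t i j + x i j := fun i j => Finset.sum_range_succ _ _
  have h2 : ∀ i < m, ∀ j ≤ n, t (i + 1) j = t i j + y i j := by
    intro i hi j hj
    induction j with
    | zero => rw [hy0 i hi]; rfl
    | succ j ih =>
      have := ih (by omega)
      have := hxy i hi j hj
      rw [h1, h1]
      omega
  refine ⟨t, ⟨fun j hj => Finset.sum_eq_zero fun j' hj' => hx0 j' ?_, fun i _ => rfl,
    fun i hi j hj => ?_, fun i hi j hj => ?_⟩, h1, h2⟩
  · have := Finset.mem_range.1 hj'
    omega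
  · have := hx i hi j hj
    rw [h1]
    omega
  · have := hy i hi j hj
    rw [h2 i hi j hj]
    omega

/-- At an internal vertex, having degree two means that the height changes determined by the four
edges add up to zero. -/
theorem surjOn_heightToFPL :
    Set.SurjOn (heightToFPL (m := m) (n := n)) (PartialHeightFunctions m n) (PartialFPLs m n) := by
  classical
  intro H (hH : IsPartialFPL H)
  let V : ℕ → ℕ → Prop := fun i j => ∃ u v : GridVertex m n, (u.row = i ∧ u.col = j + 1) ∧
    (v.row = i + 1 ∧ v.col = j + 1) ∧ H.Adj u v
  let W : ℕ → ℕ → Prop := fun i j => ∃ u v : GridVertex m n, (u.row = i + 1 ∧ u.col = j) ∧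
    (v.row = i + 1 ∧ v.col = j + 1) ∧ H.Adj u v
  have hV : ∀ {u v : GridVertex m n} {i j : ℕ}, u.row = i ∧ u.col = j + 1 →
      v.row = i + 1 ∧ v.col = j + 1 → (H.Adj u v ↔ V i j) := by
    intro u v i j hu hv
    refine ⟨fun h => ⟨u, v, hu, hv, h⟩, ?_⟩
    rintro ⟨u', v', hu', hv', h⟩
    rwa [GridVertex.ext_row_col (hu.1.trans hu'.1.symm) (hu.2.trans hu'.2.symm),
      GridVertex.ext_row_col (hv.1.trans hv'.1.symm) (hv.2.trans hv'.2.symm)]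
  have hW : ∀ {u v : GridVertex m n} {i j : ℕ}, u.row = i + 1 ∧ u.col = j →
      v.row = i + 1 ∧ v.col = j + 1 → (H.Adj u v ↔ W i j) := by
    intro u v i j hu hv
    refine ⟨fun h => ⟨u, v, hu, hv, h⟩, ?_⟩
    rintro ⟨u', v', hu', hv', h⟩
    rwa [GridVertex.ext_row_col (hu.1.trans hu'.1.symm) (hu.2.trans hu'.2.symm),
      GridVertex.ext_row_col (hv.1.trans hv'.1.symm) (hv.2.trans hv'.2.symm)]
  obtain ⟨x, hx⟩ := exists_indicator_iff V fun i j => (i + j) % 2 = 0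
  obtain ⟨y, hy⟩ := exists_indicator_iff W fun i j => (i + j) % 2 = 1
  obtain ⟨t, ht, htx, hty⟩ := exists_isDepth_of_steps (m := m) (n := n) x y
    (fun i _ j _ => (hx i j).1) (fun i _ j _ => (hy i j).1)
    (fun j hj => by
      obtain ⟨u, hu⟩ := GridVertex.exists_row_col (m := m) (n := n) (i := 0) (j := j + 1) (by omega)
      obtain ⟨v, hv⟩ := GridVertex.exists_row_col (m := m) (n := n) (i := 1) (j := j + 1) (by omega)
      have e := hH.top u v hu.1 hv.1 (hu.2.trans hv.2.symm)
      rw [hV hu (by omega), (hx 0 j).2, hu.2, Nat.odd_iff] at e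
      omega)
    (fun i hi => by
      obtain ⟨u, hu⟩ := GridVertex.exists_row_col (m := m) (n := n) (i := i + 1) (j := 0) (by omega)
      obtain ⟨v, hv⟩ := GridVertex.exists_row_col (m := m) (n := n) (i := i + 1) (j := 1) (by omega)
      have e := hH.left u v hu.2 hv.2 (hu.1.trans hv.1.symm)
      rw [hW hu (by omega), (hy i 0).2, hu.1, Nat.even_iff] at e
      omega)
    (fun i hi j hj => by
      obtain ⟨v, hv⟩ := GridVertex.exists_row_col (m := m) (n := n) (i := i + 1) (j := j + 1)
        (by omega)
      have hint : v.IsInternal := by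
        rw [GridVertex.IsInternal]
        omega
      obtain ⟨a, b, c, d, ha, hb, hc, hd, -, -, -, -, hcard⟩ := exists_neighbors hint
      obtain ⟨xa, xb, xc, xd, hsum, hxa, hxb, hxc, hxd⟩ :=
        hcard (fun u => H.Adj v u) fun u hu => hH.le_grid hu
      have hdeg := hsum.symm.trans (hH.degree v hint)
      have ea := hV (u := a) (v := v) (i := i) (j := j) (by omega) (by omega)
      have eb := hV (u := v) (v := b) (i := i + 1) (j := j) (by omega) (by omega)
      have ec := hW (u := c) (v := v) (i := i) (j := j) (by omega) (by omega)
      have ed := hW (u := v) (v := d) (i := i) (j := j + 1) (by omega) (by omega)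
      rw [SimpleGraph.adj_comm, (hx i j).2] at ea
      rw [(hx (i + 1) j).2] at eb
      rw [SimpleGraph.adj_comm, (hy i j).2] at ec
      rw [(hy i (j + 1)).2] at ed
      rw [ea] at hxa
      rw [eb, Nat.add_right_comm] at hxb
      rw [ec] at hxc
      rw [ed, ← Nat.add_assoc] at hxd
      exact (add_eq_two_iff (hx i j).1 (hx (i + 1) j).1 (hy i j).1 (hy i (j + 1)).1
        hxa hxb hxc hxd).1 hdeg)
  let h : Matrix (Fin (m + 1)) (Fin (n + 1)) ℤ := fun i j => i.val + j.val - 2 * t i j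
  refine ⟨h, ht.isPartialHeightFunction fun _ _ => rfl, ?_⟩
  refine eq_of_le_gridGraph (heightToFPL_le_gridGraph h) hH.le_grid
    (fun u v i hi j hj hu hv => ?_) fun u v i hi j hj hu hv => ?_
  · rw [ht.heightToFPL_adj_vertical (fun _ _ => rfl) hi hj hu hv, hV hu hv, (hx i j).2, htx i j]
    omega
  · rw [ht.heightToFPL_adj_horizontal (fun _ _ => rfl) hi hj hu hv, hW hu hv, (hy i j).2,
      hty i hi j hj]
    omega

theorem bijOn_heightToFPL :
    Set.BijOn (heightToFPL (m := m) (n := n)) (PartialHeightFunctions m n) (PartialFPLs m n) := by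
  refine ⟨fun h hh => ?_, injOn_heightToFPL, surjOn_heightToFPL⟩
  obtain ⟨t, ht, htt⟩ := IsPartialHeightFunction.exists_isDepth hh
  exact ht.isPartialFPL_heightToFPL htt

end PartialASM

theorem theorem3p2 (m n : ℕ) :
    Set.BijOn PartialASM.pasmToTriangle
      (PartialASM.PASM m n) (PartialASM.PartialMonotoneTriangles m n) ∧
    Set.BijOn PartialASM.pasmToHeight
      (PartialASM.PASM m n) (PartialASM.PartialHeightFunctions m n) ∧
    Set.BijOn PartialASM.heightToFPL
      (PartialASM.PartialHeightFunctions m n) (PartialASM.PartialFPLs m n) ∧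
    Set.BijOn PartialASM.iceToFPL
      (PartialASM.RectangularIce m n) (PartialASM.PartialFPLs m n) ∧
    Set.BijOn PartialASM.idealToHeight
      (Set.univ : Set (LowerSet (PartialASM.PASMPoset m n)))
      (PartialASM.PartialHeightFunctions m n) ∧
    Set.BijOn PartialASM.pasmToNest
      (PartialASM.PASM m n) (PartialASM.Nests m n) :=
  ⟨PartialASM.bijOn_pasmToTriangle, PartialASM.bijOn_pasmToHeight, PartialASM.bijOn_heightToFPL,
    PartialASM.bijOn_iceToFPL, PartialASM.bijOn_idealToHeight, PartialASM.bijOn_pasmToNest⟩
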